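/- Let $H$ be a separable real Hilbert space with inner product $\langle\cdot,\cdot\rangle$ and norm $\|\cdot\|$, and let $X$ be a random variable with values in $H$ such that (A1) for all $h\in H$ there is $h'\in H$ with $\langle h,h'\rangle=0$ and $\operatorname{Var}(\langle X,h'\rangle)>0$ (the variance being taken in $[0,\infty]$); (A2) there is a constant $C>0$ such that for all $h\in H$, $\mathbb{E}\big[\tfrac{1}{\|X-h\|}\big]\le C$ and $\mathbb{E}\big[\tfrac{1}{\|X-h\|^{2}}\big]\le C$ (with the convention $1/0=\infty$). Let $m$ be the geometric median of $X$, i.e. the minimizer over $h\in H$ of $\mathbb{E}\big[\|X-h\|-\|X\|\big]$. Let $X_1,X_2,\dots$ be independent random variables with the same law as $X$, let $\gamma_n=c_\gamma n^{-\alpha}$ with $c_\gamma>0$ and $\alpha\in(1/2,1)$, and let $Z_1$ be an almost surely bounded $H$-valued random variable that is independent of $(X_2,X_3,\dots)$ (for example a deterministic vector, or a bounded measurable function of $X_1$). Define, for $n\ge1$, $$Z_{n+1}=Z_n+\gamma_n\frac{X_{n+1}-Z_n}{\|X_{n+1}-Z_n\|},\qquad \overline{Z}_n=\frac1n\sum_{k=1}^n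 Z_k .$$ Then for every integer $p\ge1$ there is a constant $A_p>0$ such that for all $n\ge1$, $$\mathbb{E}\big[\|\overline{Z}_n-m\|^{2p}\big]\le\frac{A_p}{n^{p}} ,$$ the expectation being finite. -/

import Mathlib

open MeasureTheory ProbabilityTheory
open scoped ENNReal

section GeometricMedian

variable {Ω : Type*}
variable {H : Type*} [NormedAddCommGroup H] [InnerProductSpace ℝ H]

/-- `m` is a geometric median of `X`: it minimizes `h ↦ 𝔼[‖X - h‖ - ‖X‖]` over `H`.
The integrand is bounded by `‖h‖`, so no moment of `X` is needed. -/
def IsGeometricMedian [MeasurableSpace Ω] (X : Ω → H) (P : Measure Ω) (m : H) : Prop :=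
  IsMinOn (fun h : H => ∫ ω, (‖X ω - h‖ - ‖X ω‖) ∂P) Set.univ m

/-- `X` is not concentrated on a straight line: for all `h` there is `h'` orthogonal to `h` with
`Var ⟨X, h'⟩ > 0`. The variance is taken with values in `[0, ∞]`, because `X` need not have
any moment; an infinite variance counts as positive. -/
def NotConcentratedOnLine [MeasurableSpace Ω] (X : Ω → H) (P : Measure Ω) : Prop :=
  ∀ h : H, ∃ h' : H, inner ℝ h h' = 0 ∧ 0 < evariance (fun ω => (inner ℝ (X ω) h' : ℝ)) P

/-- `X` is not concentrated around single points: `𝔼[1/‖X - h‖] ≤ C` and `𝔼[1/‖X - h‖²] ≤ C`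
with one constant `C > 0` for all `h`. The expectations are taken in `[0, ∞]`, with `1/0 = ∞`. -/
def NotConcentratedAroundPoints [MeasurableSpace Ω] (X : Ω → H) (P : Measure Ω) : Prop :=
  ∃ C : ℝ, 0 < C ∧ ∀ h : H,
    ∫⁻ ω, (‖X ω - h‖ₑ)⁻¹ ∂P ≤ ENNReal.ofReal C ∧
    ∫⁻ ω, (‖X ω - h‖ₑ ^ 2)⁻¹ ∂P ≤ ENNReal.ofReal C

/-- The stochastic gradient (Robbins-Monro) algorithm started at `Z₁`, indexed from `1`:
`Z_{n+1} = Z_n + γ_n (X_{n+1} - Z_n) / ‖X_{n+1} - Z_n‖` for `n ≥ 1`.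
The value at index `0` is never used. -/
noncomputable def robbinsMonro (γ : ℕ → ℝ) (X : ℕ → Ω → H) (Z₁ : Ω → H) : ℕ → Ω → H
  | 0 => 0
  | 1 => Z₁
  | n + 2 => fun ω =>
      robbinsMonro γ X Z₁ (n + 1) ω +
        (γ (n + 1) / ‖X (n + 2) ω - robbinsMonro γ X Z₁ (n + 1) ω‖) •
          (X (n + 2) ω - robbinsMonro γ X Z₁ (n + 1) ω)

/-- The averaged sequence `n⁻¹ ∑_{k=1}^n Z_k`, for `n ≥ 1`. -/
noncomputable def averaged (Z : ℕ → Ω → H) (n : ℕ) (ω : Ω) : H :=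
  (n : ℝ)⁻¹ • ∑ k ∈ Finset.Icc 1 n, Z k ω

/-- The average starts at `Z_1`. -/
theorem averaged_one (Z : ℕ → Ω → H) (ω : Ω) : averaged Z 1 ω = Z 1 ω := by
  simp [averaged]

/-- The average satisfies its iterative description. -/
theorem averaged_succ (Z : ℕ → Ω → H) {n : ℕ} (hn : 1 ≤ n) (ω : Ω) :
    averaged Z (n + 1) ω =
      averaged Z n ω - (1 / ((n : ℝ) + 1)) • (averaged Z n ω - Z (n + 1) ω) := by
  have h0 : (n : ℝ) ≠ 0 := by positivity
  have h1 : (n : ℝ) + 1 ≠ 0 := by positivity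
  simp only [averaged, Finset.sum_Icc_succ_top (Nat.le_add_left 1 n)]
  generalize ∑ k ∈ Finset.Icc 1 n, Z k ω = s
  generalize Z (n + 1) ω = z
  push_cast
  match_scalars
  · field_simp
    ring
  · field_simp

end GeometricMedian

/-!
The algorithm is a stochastic gradient descent for `G h = 𝔼[‖X - h‖ - ‖X‖]`. Its increments are
bounded, and `G` is smooth enough at `m` for a second order expansion, but `G` grows only linearly,
so the drift towards `m` is quadratic in the error `t = Z - m` near `m` and only linear far away.

*Analysis of `G`.* The derivative of `a ↦ a / ‖a‖` has a Taylor bound `4 ‖h‖² / ‖a‖²` that holds for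
all `h` (`norm_direction_sub_taylor_le`), so `𝔼[‖X - m‖⁻²] < ∞` alone linearizes `∇G` at `m` with a
quadratic error. The Hessian at `m` is coercive also in infinite dimension
(`exists_le_inner_hessian_self`): its quadratic form at a unit vector `v` is a weighted mean of the
squared sines of the angles between `v` and `X - m`, with weight `‖X - m‖⁻¹`. By a triangle
inequality for sines, it is bounded below by a multiple of the mean squared sine of the angle between
two independent copies of `X - m`, with the same weights, and this does not depend on `v`. Convexity along rays extends the local bound to a global drift
(`exists_le_neg_inner_meanDirection`).

*Moments of the iterates.* The Lyapunov function `u = exp (√(1 + ‖t‖²) - 1) - 1` is of the order of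
`‖t‖²` near `0`, and grows exponentially. Hence the drift lowers it by a fixed multiple of `γ_n u`
everywhere, and one step gives, for `w = u + γ_n`,
`𝔼[w_{n+1}^(q+1)] ≤ (1 - κ γ_n) 𝔼[w_n^(q+1)] + C γ_n² 𝔼[w_n^q]`
(`exists_integral_potential_pow_le`). Induction on `q` yields `𝔼[‖Z_n - m‖^(2q)] = O(γ_n^q)` for all
`q`. The martingale part `M_n` satisfies `𝔼[‖M_n‖^(2q)] = O(n^q)` by the same one-step estimate.

*Averaging.* Summation by parts (`sum_hessian_eq`) writes `n` times the Hessian at `Z̄_n - m` as the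
martingale `M_{n+1}`, boundary terms `(Z_k - m) / γ_k`, and sums of terms whose `L^(2p)` norms are at
most of the order of `k^(-1/2)`, since `1/2 < α < 1`. All this is `O(√n)` in `L^(2p)`, and coercivity
of the Hessian transfers the bound to `n (Z̄_n - m)`.
-/

/-! ### The direction of a vector -/

section Direction

variable {H : Type*} [NormedAddCommGroup H] [InnerProductSpace ℝ H]

/-- The direction `a / ‖a‖` of a vector, with the value `0` at `a = 0`. It is the gradient of the
norm away from the origin, and a subgradient everywhere. -/
noncomputable def direction (a : H) : H := ‖a‖⁻¹ • a

theorem norm_direction_le_one (a : H) : ‖direction a‖ ≤ 1 := by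
  rw [direction, norm_smul, norm_inv, norm_norm]
  exact inv_mul_le_one

theorem norm_smul_direction (a : H) : ‖a‖ • direction a = a := by
  rcases eq_or_ne a 0 with rfl | ha
  · simp
  · rw [direction, smul_smul, mul_inv_cancel₀ (norm_ne_zero_iff.2 ha), one_smul]

theorem norm_direction {a : H} (ha : a ≠ 0) : ‖direction a‖ = 1 := by
  rw [direction, norm_smul, norm_inv, norm_norm, inv_mul_cancel₀ (norm_ne_zero_iff.2 ha)]

theorem inner_direction_self (a : H) : inner ℝ (direction a) a = ‖a‖ := by
  rw [direction, real_inner_smul_left, real_inner_self_eq_norm_sq]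
  rcases eq_or_ne ‖a‖ 0 with h | h
  · simp [h]
  · field_simp

theorem inner_direction_le (a b : H) : inner ℝ (direction a) b ≤ ‖b‖ := by
  refine (real_inner_le_norm _ _).trans ?_
  have := mul_le_mul_of_nonneg_right (norm_direction_le_one a) (norm_nonneg b)
  simpa using this

/-- The direction is a subgradient of the norm. -/
theorem norm_add_inner_direction_le (a b : H) :
    ‖b‖ + inner ℝ (direction b) (a - b) ≤ ‖a‖ := by
  rw [inner_sub_right, inner_direction_self]
  linarith [inner_direction_le b a]

theorem inner_direction_sub_direction_nonneg (a b : H) :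
    0 ≤ inner ℝ (direction a - direction b) (a - b) := by
  rw [inner_sub_left]
  have h1 := norm_add_inner_direction_le a b
  have h2 := norm_add_inner_direction_le b a
  rw [← neg_sub a b, inner_neg_right] at h2
  linarith

theorem norm_smul_direction_sub_le (a b : H) :
    ‖b‖ * ‖direction a - direction b‖ ≤ 2 * ‖a - b‖ := by
  have h : ‖b‖ • (direction a - direction b) = (‖b‖ - ‖a‖) • direction a + (a - b) := by
    rw [smul_sub, norm_smul_direction, sub_smul, norm_smul_direction]; abel
  have h2 : ‖b‖ * ‖direction a - direction b‖ = ‖‖b‖ • (direction a - direction b)‖ := by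
    rw [norm_smul, norm_norm]
  rw [h2, h]
  refine (norm_add_le _ _).trans ?_
  rw [norm_smul]
  have h3 : ‖‖b‖ - ‖a‖‖ ≤ ‖a - b‖ := by
    rw [Real.norm_eq_abs, abs_sub_comm]; exact abs_norm_sub_norm_le a b
  have h4 := mul_le_mul h3 (norm_direction_le_one a) (norm_nonneg _) (norm_nonneg _)
  linarith

/-- The derivative of `direction` at `a` in direction `h`: the projection of `h` on the
orthogonal complement of `a`, divided by `‖a‖`. -/
noncomputable def directionDeriv (a h : H) : H :=
  ‖a‖⁻¹ • (h - (inner ℝ (direction a) h : ℝ) • direction a)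

/-- A second order Taylor bound for the direction. It holds for all increments, also for those
that pass through the singularity at the origin, because it blows up like `‖a‖⁻²`. -/
theorem norm_direction_sub_taylor_le {a : H} (ha : a ≠ 0) (h : H) :
    ‖direction (a - h) - direction a + directionDeriv a h‖ ≤ 4 * ‖h‖ ^ 2 * (‖a‖⁻¹) ^ 2 := by
  have hr : 0 < ‖a‖ := norm_pos_iff.2 ha
  by_cases hb : a - h = 0
  · have : h = a := (sub_eq_zero.1 hb).symm
    subst this
    have h1 : directionDeriv h h = 0 := by
      rw [directionDeriv, inner_direction_self, norm_smul_direction, sub_self, smul_zero]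
    rw [h1, hb]
    have : direction (0 : H) = 0 := by simp [direction]
    rw [this, zero_sub, add_zero, norm_neg, norm_direction ha]
    field_simp
    norm_num
  set b := a - h with hbdef
  have hs : 0 < ‖b‖ := norm_pos_iff.2 hb
  have hhb : h = a - b := by rw [hbdef]; abel
  set u := direction a with hu
  set v := direction b with hv
  have hu1 : ‖u‖ = 1 := norm_direction ha
  have hv1 : ‖v‖ = 1 := norm_direction hb
  have hau : ‖a‖ • u = a := norm_smul_direction a
  have hbv : ‖b‖ • v = b := norm_smul_direction b
  have key : v - u + directionDeriv a h =
      ‖a‖⁻¹ • ((‖a‖ - ‖b‖) • (v - u) - (‖b‖ / 2 * ‖v - u‖ ^ 2) • u) := by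
    have hin : (inner ℝ u h : ℝ) = ‖a‖ - ‖b‖ * inner ℝ u v := by
      rw [hhb, inner_sub_right, hu, inner_direction_self, ← hu]
      conv_lhs => rw [← hbv]
      rw [real_inner_smul_right]
    have hsq : ‖v - u‖ ^ 2 = 2 - 2 * inner ℝ u v := by
      rw [norm_sub_sq_real, hu1, hv1, real_inner_comm]; ring
    rw [directionDeriv, ← hu, hin, hsq]
    have : h = ‖a‖ • u - ‖b‖ • v := by rw [hau, hbv, hhb]
    rw [this]
    match_scalars <;> field_simp <;> ring
  have e1 : ‖a‖ * ‖v - u‖ ≤ 2 * ‖h‖ := by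
    have := norm_smul_direction_sub_le b a
    rwa [norm_sub_rev b a, ← hhb] at this
  have e2 : ‖b‖ * ‖v - u‖ ≤ 2 * ‖h‖ := by
    have := norm_smul_direction_sub_le a b
    rwa [norm_sub_rev (direction a), ← hhb] at this
  have e3 : |‖a‖ - ‖b‖| ≤ ‖h‖ := by rw [hhb]; exact abs_norm_sub_norm_le a b
  rw [key, norm_smul, norm_inv, norm_norm]
  have e4 : ‖(‖a‖ - ‖b‖) • (v - u) - (‖b‖ / 2 * ‖v - u‖ ^ 2) • u‖ ≤
      ‖h‖ * ‖v - u‖ + ‖h‖ * ‖v - u‖ := by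
    refine (norm_sub_le _ _).trans ?_
    rw [norm_smul, norm_smul, hu1, Real.norm_eq_abs, Real.norm_eq_abs, mul_one,
      abs_of_nonneg (by positivity : (0 : ℝ) ≤ ‖b‖ / 2 * ‖v - u‖ ^ 2)]
    refine add_le_add (mul_le_mul_of_nonneg_right e3 (norm_nonneg _)) ?_
    nlinarith [mul_le_mul_of_nonneg_right e2 (norm_nonneg (v - u))]
  have e5 : ‖v - u‖ ≤ 2 * ‖h‖ * ‖a‖⁻¹ := by
    rw [← div_eq_mul_inv, le_div_iff₀ hr]; linarith
  calc ‖a‖⁻¹ * ‖(‖a‖ - ‖b‖) • (v - u) - (‖b‖ / 2 * ‖v - u‖ ^ 2) • u‖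
      ≤ ‖a‖⁻¹ * (‖h‖ * (2 * ‖h‖ * ‖a‖⁻¹) + ‖h‖ * (2 * ‖h‖ * ‖a‖⁻¹)) := by
        refine mul_le_mul_of_nonneg_left (e4.trans ?_) (by positivity)
        gcongr
    _ = _ := by ring

/-- The sines of the angles between lines obey a triangle inequality. -/
theorem one_sub_inner_sq_le {a b v : H} (ha : ‖a‖ = 1) (hb : ‖b‖ = 1) (hv : ‖v‖ = 1) :
    1 - (inner ℝ a b : ℝ) ^ 2 ≤
      2 * (1 - (inner ℝ a v : ℝ) ^ 2) + 2 * (1 - (inner ℝ b v : ℝ) ^ 2) := by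
  set p : ℝ := inner ℝ a v
  set q : ℝ := inner ℝ b v
  set s : ℝ := inner ℝ (a - p • v) (b - q • v) with hs
  have hva : (inner ℝ v a : ℝ) = p := real_inner_comm _ _
  have hvb : (inner ℝ v b : ℝ) = q := real_inner_comm _ _
  have hvv : (inner ℝ v v : ℝ) = 1 := by rw [real_inner_self_eq_norm_sq, hv]; norm_num
  have hab : (inner ℝ a b : ℝ) = p * q + s := by
    have hav : (inner ℝ a v : ℝ) = p := rfl
    rw [hs, inner_sub_left, inner_sub_right, inner_sub_right, real_inner_smul_left,
      real_inner_smul_left, real_inner_smul_right, real_inner_smul_right, hvv, hvb, hav]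
    ring
  have hn (c : H) (t : ℝ) (hc : ‖c‖ = 1) (ht : (inner ℝ c v : ℝ) = t) :
      ‖c - t • v‖ ^ 2 = 1 - t ^ 2 := by
    rw [norm_sub_sq_real, real_inner_smul_right, ht, norm_smul, hc, hv]
    simp only [Real.norm_eq_abs, mul_one, sq_abs]; ring
  have hA := hn a p ha rfl
  have hB := hn b q hb rfl
  have hsle : |s| ≤ ‖a - p • v‖ * ‖b - q • v‖ := abs_real_inner_le_norm _ _
  have hs2 : 2 * |s| ≤ (1 - p ^ 2) + (1 - q ^ 2) := by
    nlinarith [sq_nonneg (‖a - p • v‖ - ‖b - q • v‖)]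
  have hp : |p| ≤ 1 := by
    have := abs_real_inner_le_norm a v; rwa [ha, hv, one_mul] at this
  have hq : |q| ≤ 1 := by
    have := abs_real_inner_le_norm b v; rwa [hb, hv, one_mul] at this
  have hpq : |p * q * s| ≤ |s| := by
    rw [abs_mul, abs_mul]
    have : |p| * |q| ≤ 1 := mul_le_one₀ hp (abs_nonneg _) hq
    nlinarith [abs_nonneg s]
  have hp2 : p ^ 2 ≤ 1 := by rw [← sq_abs]; nlinarith [abs_nonneg p]
  have hq2 : q ^ 2 ≤ 1 := by rw [← sq_abs]; nlinarith [abs_nonneg q]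
  rw [hab]
  nlinarith [neg_abs_le (p * q * s), sq_nonneg s, mul_nonneg (sub_nonneg.2 hp2) (sub_nonneg.2 hq2)]

theorem measurable_direction [MeasurableSpace H] [BorelSpace H] [SecondCountableTopology H] :
    Measurable (direction : H → H) := by
  unfold direction; fun_prop

end Direction

/-! ### The mean direction, the Hessian and the drift -/

section MeanDirection

variable {H : Type*} [NormedAddCommGroup H] [InnerProductSpace ℝ H]

theorem directionDeriv_add (a h k : H) :
    directionDeriv a (h + k) = directionDeriv a h + directionDeriv a k := by
  rw [directionDeriv, directionDeriv, directionDeriv, inner_add_right]; module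

theorem directionDeriv_smul (a : H) (t : ℝ) (h : H) :
    directionDeriv a (t • h) = t • directionDeriv a h := by
  rw [directionDeriv, directionDeriv, real_inner_smul_right]; module

theorem norm_directionDeriv_le (a h : H) : ‖directionDeriv a h‖ ≤ ‖a‖⁻¹ * (2 * ‖h‖) := by
  rw [directionDeriv, norm_smul, norm_inv, norm_norm]
  refine mul_le_mul_of_nonneg_left ((norm_sub_le _ _).trans ?_) (by positivity)
  have h1 : ‖(inner ℝ (direction a) h : ℝ) • direction a‖ ≤ ‖h‖ := by
    rw [norm_smul]
    have h2 : ‖(inner ℝ (direction a) h : ℝ)‖ ≤ ‖h‖ :=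
      (norm_inner_le_norm _ _).trans
        (mul_le_of_le_one_left (norm_nonneg _) (norm_direction_le_one a))
    exact (mul_le_of_le_one_right (norm_nonneg _) (norm_direction_le_one a)).trans h2
  linarith

theorem inner_directionDeriv_self (a h : H) :
    (inner ℝ (directionDeriv a h) h : ℝ) =
      ‖a‖⁻¹ * (‖h‖ ^ 2 - (inner ℝ (direction a) h : ℝ) ^ 2) := by
  rw [directionDeriv, real_inner_smul_left, inner_sub_left, real_inner_smul_left,
    real_inner_self_eq_norm_sq]; ring

theorem inner_directionDeriv_self_nonneg (a h : H) :
    0 ≤ (inner ℝ (directionDeriv a h) h : ℝ) := by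
  rw [inner_directionDeriv_self]
  refine mul_nonneg (by positivity) (sub_nonneg.2 ?_)
  rw [← sq_abs (inner ℝ _ _)]
  gcongr
  exact (abs_real_inner_le_norm _ _).trans
    (mul_le_of_le_one_left (norm_nonneg _) (norm_direction_le_one a))

variable [MeasurableSpace H]

/-- The mean direction from `h` to a point with law `μ`. This is minus the gradient of
`h ↦ 𝔼[‖X - h‖ - ‖X‖]`, the function that the geometric median minimizes. -/
noncomputable def meanDirection (μ : Measure H) (h : H) : H := ∫ x, direction (x - h) ∂μ

variable [SecondCountableTopology H] [BorelSpace H]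

theorem stronglyMeasurable_meanDirection (μ : Measure H) [SFinite μ] :
    StronglyMeasurable (meanDirection μ) := by
  have : Measurable (fun z : H × H => direction (z.2 - z.1)) :=
    measurable_direction.comp (measurable_snd.sub measurable_fst)
  exact this.stronglyMeasurable.integral_prod_right'

theorem integrable_directionDeriv {μ : Measure H} {m : H}
    (hw : Integrable (fun x => ‖x - m‖⁻¹) μ) (h : H) :
    Integrable (fun x => directionDeriv (x - m) h) μ := by
  refine (hw.mul_const (2 * ‖h‖)).mono' ?_
    (Filter.Eventually.of_forall fun x => norm_directionDeriv_le _ _)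
  have hd : Measurable (fun x => direction (x - m)) :=
    measurable_direction.comp (measurable_id.sub_const m)
  unfold directionDeriv
  exact (by fun_prop : Measurable _).aestronglyMeasurable

/-- The Hessian at `m` of `h ↦ 𝔼[‖X - h‖ - ‖X‖]`, for `X` with law `μ`. -/
noncomputable def hessian {μ : Measure H} {m : H}
    (hw : Integrable (fun x => ‖x - m‖⁻¹) μ) : H →ₗ[ℝ] H where
  toFun h := ∫ x, directionDeriv (x - m) h ∂μ
  map_add' h k := by
    rw [← integral_add (integrable_directionDeriv hw h) (integrable_directionDeriv hw k)]
    simp_rw [directionDeriv_add]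
  map_smul' t h := by
    simp_rw [directionDeriv_smul, RingHom.id_apply]
    exact integral_smul _ _

theorem hessian_apply {μ : Measure H} {m : H}
    (hw : Integrable (fun x => ‖x - m‖⁻¹) μ) (h : H) :
    hessian hw h = ∫ x, directionDeriv (x - m) h ∂μ := rfl

theorem continuous_hessian {μ : Measure H} {m : H}
    (hw : Integrable (fun x => ‖x - m‖⁻¹) μ) : Continuous (hessian hw) := by
  refine AddMonoidHomClass.continuous_of_bound (hessian hw) (2 * ∫ x, ‖x - m‖⁻¹ ∂μ) fun h => ?_
  rw [hessian_apply]
  refine (norm_integral_le_integral_norm _).trans ?_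
  refine (integral_mono (integrable_directionDeriv hw h).norm (hw.mul_const (2 * ‖h‖))
    fun x => norm_directionDeriv_le _ _).trans_eq ?_
  rw [integral_mul_const]; ring

theorem inner_hessian_self [CompleteSpace H] {μ : Measure H} {m : H}
    (hw : Integrable (fun x => ‖x - m‖⁻¹) μ) (h : H) :
    (inner ℝ (hessian hw h) h : ℝ) =
      ∫ x, ‖x - m‖⁻¹ * (‖h‖ ^ 2 - (inner ℝ (direction (x - m)) h : ℝ) ^ 2) ∂μ := by
  rw [real_inner_comm, hessian_apply, ← integral_inner (integrable_directionDeriv hw h)]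
  simp_rw [← inner_directionDeriv_self, real_inner_comm h]

/-- If `μ` is not concentrated on a line through `m`, the second derivative in each direction is
positive. -/
theorem inner_hessian_self_pos [CompleteSpace H] {μ : Measure H} {m : H}
    (hw : Integrable (fun x => ‖x - m‖⁻¹) μ) (hne : ∀ᵐ x ∂μ, x ≠ m)
    (hline : ∀ v : H, ∃ h' : H, inner ℝ v h' = 0 ∧ ¬ ∀ᵐ x ∂μ, inner ℝ (x - m) h' = 0)
    {v : H} (hv : ‖v‖ = 1) : 0 < (inner ℝ (hessian hw v) v : ℝ) := by
  obtain ⟨h', hvh, hnot⟩ := hline v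
  have hint := (integrable_directionDeriv hw v).inner_const v (𝕜 := ℝ)
  have hnn : ∀ x, 0 ≤ (inner ℝ (directionDeriv (x - m) v) v : ℝ) :=
    fun x => inner_directionDeriv_self_nonneg _ _
  have heq : (inner ℝ (hessian hw v) v : ℝ) =
      ∫ x, inner ℝ (directionDeriv (x - m) v) v ∂μ := by
    rw [inner_hessian_self]; simp_rw [inner_directionDeriv_self]
  rw [heq]
  refine lt_of_le_of_ne (integral_nonneg hnn) fun h0 => hnot ?_
  have hae := (integral_eq_zero_iff_of_nonneg hnn hint).1 h0.symm
  filter_upwards [hae, hne] with x hx hxm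
  have hr : x - m ≠ 0 := sub_ne_zero.2 hxm
  simp only [Pi.zero_apply] at hx
  rw [inner_directionDeriv_self, hv] at hx
  have hsq : (inner ℝ (direction (x - m)) v : ℝ) ^ 2 = 1 := by
    rcases mul_eq_zero.1 hx with h | h
    · exact absurd h (inv_ne_zero (norm_ne_zero_iff.2 hr))
    · linarith
  have hdir : direction (x - m) = (inner ℝ (direction (x - m)) v : ℝ) • v := by
    rw [← sub_eq_zero, ← norm_eq_zero, ← sq_eq_zero_iff, norm_sub_sq_real, real_inner_smul_right,
      norm_smul, norm_direction hr, hv, Real.norm_eq_abs, mul_one, sq_abs]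
    linarith
  rw [← norm_smul_direction (x - m), hdir, real_inner_smul_left, real_inner_smul_left, hvh]
  simp

variable (μ : Measure H) [IsProbabilityMeasure μ]

theorem integrable_direction (h : H) : Integrable (fun x => direction (x - h)) μ :=
  Integrable.of_bound
    (measurable_direction.comp (measurable_id.sub_const h)).aestronglyMeasurable 1
    (Filter.Eventually.of_forall fun _ => norm_direction_le_one _)

theorem norm_meanDirection_le_one (h : H) : ‖meanDirection μ h‖ ≤ 1 := by
  refine (norm_integral_le_integral_norm _).trans ?_
  refine (integral_mono (integrable_direction μ h).norm (integrable_const (1 : ℝ))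
    fun x => norm_direction_le_one _).trans ?_
  simp

theorem norm_meanDirection_taylor_le {μ : Measure H} [IsProbabilityMeasure μ] {m : H}
    (hw : Integrable (fun x => ‖x - m‖⁻¹) μ)
    (hw2 : Integrable (fun x => ‖x - m‖⁻¹ ^ 2) μ) (hne : ∀ᵐ x ∂μ, x ≠ m) (h : H) :
    ‖meanDirection μ (m + h) - meanDirection μ m + hessian hw h‖ ≤
      (4 * ∫ x, ‖x - m‖⁻¹ ^ 2 ∂μ) * ‖h‖ ^ 2 := by
  have e : meanDirection μ (m + h) - meanDirection μ m + hessian hw h =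
      ∫ x, (direction (x - m - h) - direction (x - m) + directionDeriv (x - m) h) ∂μ := by
    have i1 := integrable_direction μ (m + h)
    simp_rw [← sub_sub] at i1
    rw [integral_add (f := fun x => direction (x - m - h) - direction (x - m))
      (i1.sub (integrable_direction μ m)) (integrable_directionDeriv hw h),
      integral_sub i1 (integrable_direction μ m)]
    simp_rw [meanDirection, hessian_apply, sub_sub]
  rw [e]
  refine (norm_integral_le_of_norm_le (hw2.const_mul (4 * ‖h‖ ^ 2)) ?_).trans_eq ?_
  · filter_upwards [hne] with x hx
    exact norm_direction_sub_taylor_le (sub_ne_zero.2 hx) h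
  · rw [integral_const_mul]; ring

variable [CompleteSpace H]

theorem inner_meanDirection (h v : H) :
    (inner ℝ (meanDirection μ h) v : ℝ) = ∫ x, inner ℝ (direction (x - h)) v ∂μ := by
  rw [real_inner_comm, meanDirection, ← integral_inner (integrable_direction μ h)]
  simp_rw [real_inner_comm v]

theorem inner_meanDirection_sub_nonpos (h k : H) :
    (inner ℝ (meanDirection μ h - meanDirection μ k) (h - k) : ℝ) ≤ 0 := by
  rw [inner_sub_left, inner_meanDirection, inner_meanDirection, ← integral_sub
    ((integrable_direction μ h).inner_const _) ((integrable_direction μ k).inner_const _)]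
  refine integral_nonpos fun x => ?_
  have := inner_direction_sub_direction_nonneg (x - h) (x - k)
  rw [sub_sub_sub_cancel_left, ← neg_sub h k, inner_neg_right, inner_sub_left] at this
  simpa using this

variable {μ} {m : H}

/-- The Hessian at `m` is coercive. By the triangle inequality for sines, the quadratic form at
any unit vector is bounded below by a multiple of its mean value over the directions of the
points of `μ` themselves, and this mean is positive; so no compactness is needed. -/
theorem exists_le_inner_hessian_self (hw : Integrable (fun x => ‖x - m‖⁻¹) μ)
    (hne : ∀ᵐ x ∂μ, x ≠ m)
    (hline : ∀ v : H, ∃ h' : H, inner ℝ v h' = 0 ∧ ¬ ∀ᵐ x ∂μ, inner ℝ (x - m) h' = 0) :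
    ∃ c : ℝ, 0 < c ∧ ∀ v : H, c * ‖v‖ ^ 2 ≤ inner ℝ (hessian hw v) v := by
  set W := ∫ x, ‖x - m‖⁻¹ ∂μ with hW
  set F : H → H → ℝ := fun y x =>
    ‖x - m‖⁻¹ * (1 - (inner ℝ (direction (x - m)) (direction (y - m)) : ℝ) ^ 2) with hF
  set K : H → ℝ := fun y => ∫ x, F y x ∂μ with hK
  have hdm : Measurable (fun x : H => direction (x - m)) :=
    measurable_direction.comp (measurable_id.sub_const m)
  have hbd (y x : H) : |1 - (inner ℝ (direction (x - m)) (direction (y - m)) : ℝ) ^ 2| ≤ 1 := by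
    have h1 : |(inner ℝ (direction (x - m)) (direction (y - m)) : ℝ)| ≤ 1 :=
      (abs_real_inner_le_norm _ _).trans (mul_le_one₀ (norm_direction_le_one _) (norm_nonneg _)
        (norm_direction_le_one _))
    rw [← sq_abs]
    rw [abs_le]
    constructor <;> nlinarith [abs_nonneg (inner ℝ (direction (x - m)) (direction (y - m)) : ℝ)]
  have hFm : Measurable (fun z : H × H => F z.1 z.2) := by
    have h1 : Measurable (fun z : H × H => direction (z.1 - m)) := hdm.comp measurable_fst
    have h2 : Measurable (fun z : H × H => direction (z.2 - m)) := hdm.comp measurable_snd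
    simp only [hF]
    fun_prop
  have hFle (y x : H) : ‖F y x‖ ≤ ‖x - m‖⁻¹ := by
    rw [hF, norm_mul, norm_inv, norm_norm, Real.norm_eq_abs]
    exact mul_le_of_le_one_right (inv_nonneg.2 (norm_nonneg _)) (hbd y x)
  have hFint (y : H) : Integrable (F y) μ :=
    hw.mono' (hFm.comp measurable_prodMk_left).aestronglyMeasurable
      (Filter.Eventually.of_forall (hFle y))
  have hKm : StronglyMeasurable K := hFm.stronglyMeasurable.integral_prod_right'
  have hKle (y : H) : ‖K y‖ ≤ W := norm_integral_le_of_norm_le hw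
    (Filter.Eventually.of_forall (hFle y))
  have hKpos : ∀ y, y ≠ m → 0 < K y := fun y hy => by
    have h1 := norm_direction (sub_ne_zero.2 hy)
    have := inner_hessian_self_pos hw hne hline h1
    rw [inner_hessian_self, h1, one_pow] at this
    exact this
  set L : ℝ := ∫ y, ‖y - m‖⁻¹ * K y ∂μ with hL
  have hwm : Measurable (fun x : H => ‖x - m‖⁻¹) := by fun_prop
  have hLint : Integrable (fun y => ‖y - m‖⁻¹ * K y) μ := by
    refine (hw.mul_const W).mono' (hwm.aestronglyMeasurable.mul hKm.aestronglyMeasurable)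
      (Filter.Eventually.of_forall fun y => ?_)
    rw [norm_mul, norm_inv, norm_norm]
    exact mul_le_mul_of_nonneg_left (hKle y) (by positivity)
  have pos_of {f : H → ℝ} (hf : Integrable f μ) (hp : ∀ y, y ≠ m → 0 < f y) :
      0 < ∫ y, f y ∂μ := by
    have h0 : 0 ≤ᵐ[μ] f := by filter_upwards [hne] with y hy using (hp y hy).le
    refine lt_of_le_of_ne (integral_nonneg_of_ae h0) fun h => ?_
    have h2 := (integral_eq_zero_iff_of_nonneg_ae h0 hf).1 h.symm
    obtain ⟨y, hy1, hy2⟩ := (h2.and hne).exists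
    exact (hp y hy2).ne' hy1
  have hinv (y : H) (hy : y ≠ m) : 0 < ‖y - m‖⁻¹ := inv_pos.2 (norm_pos_iff.2 (sub_ne_zero.2 hy))
  have hWpos : 0 < W := pos_of hw hinv
  have hLpos : 0 < L := pos_of hLint fun y hy => mul_pos (hinv y hy) (hKpos y hy)
  have hunit (v : H) (hv : ‖v‖ = 1) : L / (4 * W) ≤ inner ℝ (hessian hw v) v := by
    set J : ℝ := inner ℝ (hessian hw v) v with hJ
    set f : H → ℝ := fun x => 1 - (inner ℝ (direction (x - m)) v : ℝ) ^ 2 with hf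
    have hJeq : J = ∫ x, ‖x - m‖⁻¹ * f x ∂μ := by rw [hJ, inner_hessian_self, hv, one_pow]
    have hfint : Integrable (fun x => ‖x - m‖⁻¹ * f x) μ := by
      have := (integrable_directionDeriv hw v).inner_const v (𝕜 := ℝ)
      simp_rw [inner_directionDeriv_self, hv, one_pow] at this
      exact this
    have hK1 (y : H) (hy : y ≠ m) : K y ≤ 2 * J + 2 * W * f y := by
      have e : 2 * J + 2 * W * f y =
          ∫ x, (2 * (‖x - m‖⁻¹ * f x) + ‖x - m‖⁻¹ * (2 * f y)) ∂μ := by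
        rw [integral_add (hfint.const_mul 2) (hw.mul_const _), integral_const_mul,
          integral_mul_const, ← hJeq]; ring
      rw [e]
      refine integral_mono_ae (hFint y) ((hfint.const_mul 2).add (hw.mul_const _)) ?_
      filter_upwards [hne] with x hx
      have := one_sub_inner_sq_le (norm_direction (sub_ne_zero.2 hx))
        (norm_direction (sub_ne_zero.2 hy)) hv
      have h2 := mul_le_mul_of_nonneg_left this (hinv x hx).le
      simp only [hF, hf]
      linarith
    have hL1 : L ≤ 4 * W * J := by
      have e : 4 * W * J = ∫ y, (‖y - m‖⁻¹ * (2 * J) + 2 * W * (‖y - m‖⁻¹ * f y)) ∂μ := by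
        rw [integral_add (hw.mul_const _) (hfint.const_mul _), integral_const_mul,
          integral_mul_const, ← hJeq]; ring
      rw [e]
      refine integral_mono_ae hLint ((hw.mul_const _).add (hfint.const_mul _)) ?_
      filter_upwards [hne] with y hy
      have h2 := mul_le_mul_of_nonneg_left (hK1 y hy) (hinv y hy).le
      linarith
    rw [div_le_iff₀ (by positivity)]
    linarith
  refine ⟨L / (4 * W), by positivity, fun v => ?_⟩
  rcases eq_or_ne v 0 with rfl | hv
  · simp
  have h1 := hunit (direction v) (norm_direction hv)
  rw [direction, map_smul, real_inner_smul_left, real_inner_smul_right] at h1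
  have hvp : 0 < ‖v‖ := norm_pos_iff.2 hv
  have h2 := mul_le_mul_of_nonneg_right h1 (by positivity : 0 ≤ ‖v‖ ^ 2)
  refine h2.trans_eq ?_
  field_simp

theorem inner_meanDirection_add_nonpos
    (hmin : ∀ h : H, 0 ≤ ∫ x, (‖x - (m + h)‖ - ‖x - m‖) ∂μ) (h : H) :
    (inner ℝ (meanDirection μ (m + h)) h : ℝ) ≤ 0 := by
  have hint : Integrable (fun x => ‖x - (m + h)‖ - ‖x - m‖) μ := by
    refine Integrable.of_bound (by fun_prop : Measurable _).aestronglyMeasurable ‖h‖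
      (Filter.Eventually.of_forall fun x => ?_)
    rw [Real.norm_eq_abs]
    refine (abs_norm_sub_norm_le _ _).trans_eq ?_
    rw [sub_sub_sub_cancel_left, sub_add_cancel_left, norm_neg]
  rw [inner_meanDirection]
  have h1 := integral_mono hint ((integrable_direction μ (m + h)).inner_const h (𝕜 := ℝ)).neg
    (fun x => by
      have := norm_add_inner_direction_le (x - m) (x - (m + h))
      rw [sub_sub_sub_cancel_left, add_sub_cancel_left] at this
      simp only [Pi.neg_apply]
      linarith)
  have h2 := hmin h
  simp only [Pi.neg_apply] at h1
  rw [integral_neg] at h1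
  linarith

theorem meanDirection_eq_zero (hw : Integrable (fun x => ‖x - m‖⁻¹) μ)
    (hw2 : Integrable (fun x => ‖x - m‖⁻¹ ^ 2) μ) (hne : ∀ᵐ x ∂μ, x ≠ m)
    (hmin : ∀ h : H, 0 ≤ ∫ x, (‖x - (m + h)‖ - ‖x - m‖) ∂μ) : meanDirection μ m = 0 := by
  set v := meanDirection μ m with hv
  set K := 4 * ∫ x, ‖x - m‖⁻¹ ^ 2 ∂μ
  have key : ∀ t : ℝ, 0 < t →
      ‖v‖ ^ 2 ≤ t * inner ℝ (hessian hw v) v + K * t ^ 2 * ‖v‖ ^ 2 * ‖v‖ := by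
    intro t ht
    have h1 := inner_meanDirection_add_nonpos hmin (t • v)
    rw [real_inner_smul_right] at h1
    have h2 : (inner ℝ (meanDirection μ (m + t • v)) v : ℝ) ≤ 0 := by
      by_contra hcon
      exact absurd h1 (not_le.2 (mul_pos ht (not_le.1 hcon)))
    have h3 := norm_meanDirection_taylor_le hw hw2 hne (t • v)
    set δ := meanDirection μ (m + t • v) - meanDirection μ m + hessian hw (t • v) with hδ
    have h4 : (inner ℝ δ v : ℝ) =
        inner ℝ (meanDirection μ (m + t • v)) v - ‖v‖ ^ 2 + t * inner ℝ (hessian hw v) v := by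
      rw [hδ, inner_add_left, inner_sub_left, map_smul, real_inner_smul_left, ← hv,
        real_inner_self_eq_norm_sq]
    have h5 : -(‖δ‖ * ‖v‖) ≤ inner ℝ δ v := (abs_le.1 (abs_real_inner_le_norm δ v)).1
    have h6 := mul_le_mul_of_nonneg_right h3 (norm_nonneg v)
    rw [norm_smul, Real.norm_eq_abs, mul_pow, sq_abs] at h6
    nlinarith
  have hlim : Filter.Tendsto
      (fun t : ℝ => t * inner ℝ (hessian hw v) v + K * t ^ 2 * ‖v‖ ^ 2 * ‖v‖)
      (nhdsWithin 0 (Set.Ioi 0)) (nhds 0) := by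
    have hc : Continuous
        (fun t : ℝ => t * inner ℝ (hessian hw v) v + K * t ^ 2 * ‖v‖ ^ 2 * ‖v‖) := by fun_prop
    have := hc.tendsto 0
    simp only [zero_mul, ne_eq, OfNat.ofNat_ne_zero, not_false_eq_true, zero_pow, mul_zero,
      add_zero] at this
    exact this.mono_left nhdsWithin_le_nhds
  have h0 : ‖v‖ ^ 2 ≤ 0 := ge_of_tendsto hlim (by
    filter_upwards [self_mem_nhdsWithin] with t ht using key t ht)
  have : ‖v‖ = 0 := by nlinarith [norm_nonneg v]
  exact norm_eq_zero.1 this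

/-- The drift of the algorithm towards `m`: quadratic near `m`, where the Hessian governs it, and
linear far away, because the gradient of a convex function is monotone along rays. -/
theorem exists_le_neg_inner_meanDirection (hw : Integrable (fun x => ‖x - m‖⁻¹) μ)
    (hw2 : Integrable (fun x => ‖x - m‖⁻¹ ^ 2) μ) (hne : ∀ᵐ x ∂μ, x ≠ m)
    (hline : ∀ v : H, ∃ h' : H, inner ℝ v h' = 0 ∧ ¬ ∀ᵐ x ∂μ, inner ℝ (x - m) h' = 0)
    (hmin : ∀ h : H, 0 ≤ ∫ x, (‖x - (m + h)‖ - ‖x - m‖) ∂μ) :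
    ∃ l : ℝ, 0 < l ∧ ∀ h : H,
      l * (‖h‖ ^ 2 / √(1 + ‖h‖ ^ 2)) ≤ -inner ℝ (meanDirection μ (m + h)) h := by
  obtain ⟨c, hc, hcoer⟩ := exists_le_inner_hessian_self hw hne hline
  have hzero := meanDirection_eq_zero hw hw2 hne hmin
  set K := 4 * ∫ x, ‖x - m‖⁻¹ ^ 2 ∂μ with hK
  have hK0 : 0 ≤ K := mul_nonneg (by norm_num) (integral_nonneg fun x => by positivity)
  set R := 1 + 2 * K / c with hR
  have hR1 : 1 ≤ R := by rw [hR]; have : 0 ≤ 2 * K / c := by positivity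
                         linarith
  have hRK : 2 * K ≤ c * R := by rw [hR]; field_simp; linarith
  refine ⟨c / (4 * R), by positivity, fun h => ?_⟩
  set r := ‖h‖ with hr
  have hr0 : 0 ≤ r := norm_nonneg h
  set t := (1 + R * r)⁻¹ with ht
  have hden : 0 < 1 + R * r := by positivity
  have ht0 : 0 < t := inv_pos.2 hden
  have ht1 : t ≤ 1 := inv_le_one_of_one_le₀ (by nlinarith)
  -- monotonicity compares `m + h` with the nearer point `m + t • h`
  have mono : -(inner ℝ (meanDirection μ (m + t • h)) h : ℝ) ≤
      -inner ℝ (meanDirection μ (m + h)) h := by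
    have h1 := inner_meanDirection_sub_nonpos μ (m + h) (m + t • h)
    have e : m + h - (m + t • h) = (1 - t) • h := by module
    rw [e, real_inner_smul_right, inner_sub_left] at h1
    rcases ht1.eq_or_lt with h2 | h2
    · rw [h2, one_smul]
    · by_contra hcon
      have : 0 < (inner ℝ (meanDirection μ (m + h)) h : ℝ) -
          inner ℝ (meanDirection μ (m + t • h)) h := by linarith
      exact absurd h1 (not_le.2 (mul_pos (by linarith) this))
  have hT := norm_meanDirection_taylor_le hw hw2 hne (t • h)
  rw [hzero, sub_zero] at hT
  set δ := meanDirection μ (m + t • h) + hessian hw (t • h) with hδ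
  have h4 : (inner ℝ δ h : ℝ) =
      inner ℝ (meanDirection μ (m + t • h)) h + t * inner ℝ (hessian hw h) h := by
    rw [hδ, inner_add_left, map_smul, real_inner_smul_left]
  have h5 : (inner ℝ δ h : ℝ) ≤ ‖δ‖ * ‖h‖ := real_inner_le_norm δ h
  have h6 := mul_le_mul_of_nonneg_right hT (norm_nonneg h)
  rw [norm_smul, Real.norm_eq_abs, abs_of_pos ht0, ← hr] at h6
  have h7 := mul_le_mul_of_nonneg_left (hcoer h) ht0.le
  have htr : t * (1 + R * r) = 1 := inv_mul_cancel₀ hden.ne'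
  have htKr : K * (t * r) ≤ c / 2 := by
    have : R * (t * r) ≤ 1 := by nlinarith
    have h8 : 0 ≤ t * r := by positivity
    nlinarith
  have h9 : c / 2 * (t * r ^ 2) ≤ -(inner ℝ (meanDirection μ (m + t • h)) h : ℝ) := by
    have h10 : K * (t * r) * (t * r ^ 2) ≤ c / 2 * (t * r ^ 2) :=
      mul_le_mul_of_nonneg_right htKr (by positivity)
    rw [← hr] at h7 h5
    nlinarith
  refine le_trans ?_ (h9.trans mono)
  set g := √(1 + r ^ 2) with hg
  have hg1 : 1 ≤ g := Real.one_le_sqrt.2 (by nlinarith)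
  have hgr : r ≤ g := Real.le_sqrt_of_sq_le (by nlinarith)
  have hgt : 1 ≤ 2 * R * (g * t) := by
    have h11 : 1 + R * r ≤ 2 * R * g := by nlinarith
    calc (1 : ℝ) = t * (1 + R * r) := htr.symm
      _ ≤ t * (2 * R * g) := mul_le_mul_of_nonneg_left h11 ht0.le
      _ = _ := by ring
  have e : c / (4 * R) * (r ^ 2 / g) = c * r ^ 2 * (4 * R * g)⁻¹ := by
    rw [div_mul_div_comm, div_eq_mul_inv]
  have hgp : 0 < g := by linarith
  rw [e, ← div_eq_mul_inv, div_le_iff₀ (by positivity)]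
  have : 0 ≤ c * r ^ 2 := by positivity
  nlinarith

end MeanDirection

/-! ### The Lyapunov function and one step of the algorithm -/

section Potential

theorem one_add_pow_le {x : ℝ} (hx : |x| ≤ 1) (q : ℕ) :
    (1 + x) ^ q ≤ 1 + q * x + 4 ^ q * x ^ 2 := by
  induction q with
  | zero => simp; positivity
  | succ q ih =>
    obtain ⟨h1, h2⟩ := abs_le.1 hx
    have h3 := mul_le_mul_of_nonneg_left ih (by linarith : 0 ≤ 1 + x)
    have hq : (q : ℝ) ≤ 4 ^ q := by exact_mod_cast (Nat.lt_pow_self (by norm_num : 1 < 4)).le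
    have h4 : (0 : ℝ) < 4 ^ q := by positivity
    rw [pow_succ', pow_succ']
    push_cast
    have h5 : (4 : ℝ) ^ q * x ^ 2 * x ≤ 4 ^ q * x ^ 2 := by
      have : 0 ≤ (4 : ℝ) ^ q * x ^ 2 := by positivity
      nlinarith
    nlinarith [mul_le_mul_of_nonneg_right hq (sq_nonneg x), mul_nonneg h4.le (sq_nonneg x)]

theorem add_pow_succ_le {w e b : ℝ} (hw : 0 < w) (he : |e| ≤ w) (heb : e ^ 2 ≤ b * w) (q : ℕ) :
    (w + e) ^ (q + 1) ≤ w ^ (q + 1) + w ^ q * ((q + 1) * e + 4 ^ (q + 1) * b) := by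
  have hx : |e / w| ≤ 1 := by rw [abs_div, abs_of_pos hw]; exact div_le_one_of_le₀ he hw.le
  have h1 := one_add_pow_le hx (q + 1)
  have h2 : w + e = w * (1 + e / w) := by field_simp
  have h3 : w * (e / w) ^ 2 ≤ b := by
    rw [div_pow, ← mul_div_assoc, div_le_iff₀ (by positivity)]; nlinarith
  have h4 : w * (e / w) = e := by field_simp
  have h5 : 0 < w ^ q := by positivity
  rw [h2, mul_pow]
  calc w ^ (q + 1) * (1 + e / w) ^ (q + 1)
      ≤ w ^ (q + 1) * (1 + (q + 1 : ℕ) * (e / w) + 4 ^ (q + 1) * (e / w) ^ 2) := by gcongr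
    _ = w ^ (q + 1) + w ^ q * ((q + 1) * (w * (e / w)) + 4 ^ (q + 1) * (w * (e / w) ^ 2)) := by
        push_cast; ring
    _ ≤ _ := by rw [h4]; gcongr

/-- The conditional moments of a positive quantity after one random step: only the mean `a` and a
bound `b` for the relative square of the increment enter. -/
theorem integral_pow_succ_le {α : Type*} [MeasurableSpace α] {μ : Measure α}
    [IsProbabilityMeasure μ] {w a b : ℝ} {e f : α → ℝ} (hw : 0 < w) (hf : AEStronglyMeasurable f μ)
    (hint : Integrable e μ) (hf0 : ∀ x, 0 ≤ f x) (hfe : ∀ x, f x ≤ w + e x) (he : ∀ x, |e x| ≤ w)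
    (heb : ∀ x, e x ^ 2 ≤ b * w) (ha : ∫ x, e x ∂μ ≤ a) (q : ℕ) :
    ∫ x, f x ^ (q + 1) ∂μ ≤ w ^ (q + 1) + w ^ q * ((q + 1) * a + 4 ^ (q + 1) * b) := by
  have hi : Integrable (fun x => f x ^ (q + 1)) μ := by
    refine Integrable.of_bound (hf.pow _) ((w + w) ^ (q + 1)) (Filter.Eventually.of_forall ?_)
    intro x
    rw [Real.norm_eq_abs, abs_of_nonneg (pow_nonneg (hf0 x) _)]
    have := (abs_le.1 (he x)).2
    exact pow_le_pow_left₀ (hf0 x) ((hfe x).trans (by linarith)) _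
  have hl : Integrable (fun x => (q + 1) * e x + 4 ^ (q + 1) * b) μ :=
    (hint.const_mul _).add (integrable_const _)
  have hr : Integrable (fun x => w ^ (q + 1) + w ^ q * ((q + 1) * e x + 4 ^ (q + 1) * b)) μ :=
    (integrable_const _).add (hl.const_mul _)
  refine (integral_mono hi hr fun x => ?_).trans ?_
  · exact (pow_le_pow_left₀ (hf0 x) (hfe x) _).trans (add_pow_succ_le hw (he x) (heb x) q)
  · rw [integral_add (integrable_const _) (hl.const_mul _), integral_const_mul,
      integral_add (hint.const_mul _) (integrable_const _), integral_const_mul]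
    simp only [integral_const, probReal_univ, one_smul]
    gcongr

variable {H : Type*} [NormedAddCommGroup H]

/-- The Lyapunov function of the algorithm, in terms of the error `t = Z - m`. It is comparable
with `‖t‖ ^ 2` near the origin and grows exponentially. The drift, which is only linear in `‖t‖`
far away, therefore decreases it by a fixed proportion everywhere. -/
noncomputable def potential (t : H) : ℝ := Real.exp (√(1 + ‖t‖ ^ 2) - 1) - 1

theorem one_le_sqrt_one_add_sq (r : ℝ) : 1 ≤ √(1 + r ^ 2) :=
  Real.one_le_sqrt.2 (by nlinarith [sq_nonneg r])

theorem norm_sq_le_potential (t : H) : ‖t‖ ^ 2 ≤ 2 * potential t := by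
  have hg := one_le_sqrt_one_add_sq ‖t‖
  have hsq : √(1 + ‖t‖ ^ 2) ^ 2 = 1 + ‖t‖ ^ 2 := Real.sq_sqrt (by positivity)
  have := Real.quadratic_le_exp_of_nonneg (sub_nonneg.2 hg)
  rw [potential]
  nlinarith

theorem potential_nonneg (t : H) : 0 ≤ potential t := by
  nlinarith [norm_sq_le_potential t, sq_nonneg ‖t‖]

theorem continuous_potential : Continuous (potential : H → ℝ) := by
  unfold potential; fun_prop

/-- The relative drift `‖t‖ ^ 2 / (1 + ‖t‖ ^ 2)` is comparable with `u / (1 + u)`, for `u` the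
potential at `t`. -/
theorem potential_le_mul (t : H) :
    potential t ≤ 2 * ((1 + potential t) * (‖t‖ ^ 2 / (1 + ‖t‖ ^ 2))) := by
  have hg := one_le_sqrt_one_add_sq ‖t‖
  have hsq : √(1 + ‖t‖ ^ 2) ^ 2 = 1 + ‖t‖ ^ 2 := Real.sq_sqrt (by positivity)
  have hρ : ‖t‖ ^ 2 / (1 + ‖t‖ ^ 2) = 1 - 1 / √(1 + ‖t‖ ^ 2) ^ 2 := by rw [hsq]; field_simp; ring
  rw [hρ]
  unfold potential
  set g := √(1 + ‖t‖ ^ 2)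
  have hE : 0 < Real.exp (g - 1) := Real.exp_pos _
  have hprod : Real.exp (g - 1) * Real.exp (-(g - 1)) = 1 := by rw [← Real.exp_add]; simp
  have h1 : 2 - g ≤ Real.exp (-(g - 1)) := by linarith [Real.add_one_le_exp (-(g - 1))]
  have h2 : 2 * (1 / g ^ 2) ≤ 1 + Real.exp (-(g - 1)) := by
    rw [mul_one_div, div_le_iff₀ (by positivity)]
    rcases le_total g 2 with h | h
    · have : (3 - g) * g ^ 2 ≤ (1 + Real.exp (-(g - 1))) * g ^ 2 := by gcongr; linarith
      nlinarith [mul_nonneg (sub_nonneg.2 hg) (sub_nonneg.2 h)]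
    · have : 1 * g ^ 2 ≤ (1 + Real.exp (-(g - 1))) * g ^ 2 := by
        gcongr; linarith [Real.exp_pos (-(g - 1))]
      nlinarith
  nlinarith

theorem mul_le_potential (t : H) :
    (1 + potential t) * (‖t‖ ^ 2 / (1 + ‖t‖ ^ 2)) ≤ 2 * potential t := by
  have hg := one_le_sqrt_one_add_sq ‖t‖
  have hsq : √(1 + ‖t‖ ^ 2) ^ 2 = 1 + ‖t‖ ^ 2 := Real.sq_sqrt (by positivity)
  have hρ : ‖t‖ ^ 2 / (1 + ‖t‖ ^ 2) = 1 - 1 / √(1 + ‖t‖ ^ 2) ^ 2 := by rw [hsq]; field_simp; ring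
  rw [hρ]
  unfold potential
  set g := √(1 + ‖t‖ ^ 2)
  have hE : 0 < Real.exp (g - 1) := Real.exp_pos _
  have hgE : g ≤ Real.exp (g - 1) := by linarith [Real.add_one_le_exp (g - 1)]
  set E := Real.exp (g - 1)
  have h1 : 2 - E ≤ E * (1 / g ^ 2) := by
    rcases le_total E 2 with h | h
    · rw [mul_one_div, le_div_iff₀ (by positivity)]
      have : (2 - E) * g ^ 2 ≤ (2 - E) * E ^ 2 := by
        gcongr
      nlinarith [mul_nonneg hE.le (sq_nonneg (E - 1))]
    · have : 0 ≤ E * (1 / g ^ 2) := by positivity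
      linarith
  linarith

variable [InnerProductSpace ℝ H]

/-- An upper bound for the increment of `√(1 + ‖t‖ ^ 2)` along a step `γ s` with `‖s‖ ≤ 1`: the
first order term, which dominates because the square root is concave. -/
noncomputable def stepIncrement (γ : ℝ) (t s : H) : ℝ :=
  (2 * γ * inner ℝ s t + γ ^ 2) / (2 * √(1 + ‖t‖ ^ 2))

theorem sqrt_norm_add_le {γ : ℝ} (t : H) {s : H} (hs : ‖s‖ ≤ 1) :
    √(1 + ‖t + γ • s‖ ^ 2) ≤ √(1 + ‖t‖ ^ 2) + stepIncrement γ t s := by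
  have hg := one_le_sqrt_one_add_sq ‖t‖
  have hsq : √(1 + ‖t‖ ^ 2) ^ 2 = 1 + ‖t‖ ^ 2 := Real.sq_sqrt (by positivity)
  rw [stepIncrement]
  set g := √(1 + ‖t‖ ^ 2)
  set D := 2 * γ * inner ℝ s t + γ ^ 2 with hD
  have hn : ‖t + γ • s‖ ^ 2 = ‖t‖ ^ 2 + 2 * γ * inner ℝ s t + γ ^ 2 * ‖s‖ ^ 2 := by
    rw [norm_add_sq_real, real_inner_smul_right, real_inner_comm, norm_smul, Real.norm_eq_abs,
      mul_pow, sq_abs]; ring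
  have hs2 : γ ^ 2 * ‖s‖ ^ 2 ≤ γ ^ 2 :=
    mul_le_of_le_one_right (sq_nonneg _) (pow_le_one₀ (norm_nonneg _) hs)
  have hV : 1 + ‖t + γ • s‖ ^ 2 ≤ g ^ 2 + D := by rw [hsq, hn, hD]; linarith
  have hnn := sq_nonneg ‖t + γ • s‖
  have e : g + D / (2 * g) = (2 * g ^ 2 + D) / (2 * g) := by field_simp
  refine Real.sqrt_le_iff.2 ⟨?_, ?_⟩
  · rw [e]; exact div_nonneg (by nlinarith) (by linarith)
  · have e2 : (g + D / (2 * g)) ^ 2 = g ^ 2 + D + (D / (2 * g)) ^ 2 := by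
      field_simp; ring
    rw [e2]; nlinarith [sq_nonneg (D / (2 * g))]

theorem abs_stepIncrement_le {γ : ℝ} (hγ : 0 ≤ γ) (t : H) {s : H} (hs : ‖s‖ ≤ 1) :
    |stepIncrement γ t s| ≤ γ + γ ^ 2 / 2 := by
  have hg := one_le_sqrt_one_add_sq ‖t‖
  have hgt : ‖t‖ ≤ √(1 + ‖t‖ ^ 2) := Real.le_sqrt_of_sq_le (by linarith)
  have hst : |(inner ℝ s t : ℝ)| ≤ ‖t‖ :=
    (abs_real_inner_le_norm _ _).trans (mul_le_of_le_one_left (norm_nonneg _) hs)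
  rw [stepIncrement, abs_div, abs_of_pos (by positivity : 0 < 2 * √(1 + ‖t‖ ^ 2)),
    div_le_iff₀ (by positivity)]
  refine (abs_add_le _ _).trans ?_
  rw [abs_mul, abs_of_nonneg (by positivity : 0 ≤ 2 * γ), abs_of_nonneg (sq_nonneg γ)]
  nlinarith [mul_le_mul_of_nonneg_left (hst.trans hgt) hγ, sq_nonneg γ]

theorem stepIncrement_sq_le {γ : ℝ} (t : H) {s : H} (hs : ‖s‖ ≤ 1) :
    stepIncrement γ t s ^ 2 ≤ 2 * γ ^ 2 * (‖t‖ ^ 2 / (1 + ‖t‖ ^ 2)) + γ ^ 4 / 2 := by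
  have hsq : √(1 + ‖t‖ ^ 2) ^ 2 = 1 + ‖t‖ ^ 2 := Real.sq_sqrt (by positivity)
  have hst : (inner ℝ s t : ℝ) ^ 2 ≤ ‖t‖ ^ 2 := by
    rw [← sq_abs]
    have : |(inner ℝ s t : ℝ)| ≤ ‖t‖ :=
      (abs_real_inner_le_norm _ _).trans (mul_le_of_le_one_left (norm_nonneg _) hs)
    gcongr
  rw [stepIncrement, div_pow, mul_pow, hsq]
  have hV := sq_nonneg ‖t‖
  have e : 2 * γ ^ 2 * (‖t‖ ^ 2 / (1 + ‖t‖ ^ 2)) + γ ^ 4 / 2 =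
      (8 * γ ^ 2 * ‖t‖ ^ 2 + 2 * γ ^ 4 * (1 + ‖t‖ ^ 2)) / (2 ^ 2 * (1 + ‖t‖ ^ 2)) := by
    field_simp; ring
  rw [e]
  gcongr
  have h1 := mul_le_mul_of_nonneg_left hst (sq_nonneg γ)
  have h2 : 0 ≤ γ ^ 4 * ‖t‖ ^ 2 := by positivity
  nlinarith [sq_nonneg (2 * γ * inner ℝ s t - γ ^ 2)]

theorem potential_add_le {γ : ℝ} (hγ : 0 ≤ γ) (hγ1 : γ ≤ 1 / 2) (t : H) {s : H} (hs : ‖s‖ ≤ 1) :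
    potential (t + γ • s) ≤ potential t +
      (1 + potential t) * (stepIncrement γ t s + stepIncrement γ t s ^ 2) := by
  set d := stepIncrement γ t s
  have hd : |d| ≤ 1 := (abs_stepIncrement_le hγ t hs).trans (by nlinarith)
  have h1 : Real.exp d ≤ 1 + d + d ^ 2 := by
    have := (abs_le.1 (Real.abs_exp_sub_one_sub_id_le hd)).2
    linarith
  have h2 : Real.exp (√(1 + ‖t + γ • s‖ ^ 2) - 1) ≤
      Real.exp (√(1 + ‖t‖ ^ 2) - 1) * Real.exp d := by
    rw [← Real.exp_add]
    exact Real.exp_le_exp.2 (by linarith [sqrt_norm_add_le (γ := γ) t hs])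
  have h3 := mul_le_mul_of_nonneg_left h1 (Real.exp_nonneg (√(1 + ‖t‖ ^ 2) - 1))
  unfold potential
  nlinarith

theorem measurable_stepIncrement [MeasurableSpace H] [BorelSpace H] [SecondCountableTopology H]
    (γ : ℝ) (t : H) : Measurable (stepIncrement γ t) := by
  unfold stepIncrement; fun_prop

set_option maxHeartbeats 1000000 in
/-- One step of the algorithm contracts the moments of the potential, up to a term of lower order.
The summand `γ` keeps the quantity away from zero, at the scale that the moments finally have. -/
theorem exists_integral_potential_pow_le [MeasurableSpace H] [BorelSpace H]
    [SecondCountableTopology H] [CompleteSpace H] {μ : Measure H} [IsProbabilityMeasure μ]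
    {m : H} {l : ℝ} (hl : 0 < l)
    (hdrift : ∀ h : H, l * (‖h‖ ^ 2 / √(1 + ‖h‖ ^ 2)) ≤ -inner ℝ (meanDirection μ (m + h)) h)
    (q : ℕ) :
    ∃ γ₀ C : ℝ, 0 < γ₀ ∧ 0 ≤ C ∧ ∀ γ, 0 < γ → γ ≤ γ₀ → ∀ z : H,
      ∫ x, (potential (z + γ • direction (x - z) - m) + γ) ^ (q + 1) ∂μ ≤
        (1 - l / 16 * γ) * (potential (z - m) + γ) ^ (q + 1) +
          C * γ ^ 2 * (potential (z - m) + γ) ^ q := by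
  set Q : ℝ := 4 ^ (q + 1) with hQ
  have hQ0 : 0 < Q := by positivity
  refine ⟨min (1 / 40) (min (l / 8) (l / (320 * Q))), (q + 1) * (1 + l / 8) + Q * 20,
    by positivity, by positivity, fun γ hγ hγ0 z => ?_⟩
  have hγ1 : γ ≤ 1 / 40 := hγ0.trans (min_le_left _ _)
  have hγ2 : γ ≤ l / 8 := hγ0.trans ((min_le_right _ _).trans (min_le_left _ _))
  have hγ3 : γ * (320 * Q) ≤ l := by
    rw [← le_div_iff₀ (by positivity)]
    exact hγ0.trans ((min_le_right _ _).trans (min_le_right _ _))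
  set t := z - m with ht
  set u := potential t with hu
  have hu0 : 0 ≤ u := potential_nonneg t
  set ρ := ‖t‖ ^ 2 / (1 + ‖t‖ ^ 2) with hρ
  have hρ0 : 0 ≤ ρ := by positivity
  have hρ1 : u ≤ 2 * ((1 + u) * ρ) := potential_le_mul t
  have hρ2 : (1 + u) * ρ ≤ 2 * u := mul_le_potential t
  set d : H → ℝ := fun x => stepIncrement γ t (direction (x - z)) with hd
  have hdm : Measurable d :=
    (measurable_stepIncrement γ t).comp (measurable_direction.comp (measurable_id.sub_const z))
  have hd1 (x : H) : |d x| ≤ γ + γ ^ 2 / 2 :=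
    abs_stepIncrement_le hγ.le t (norm_direction_le_one _)
  have hd2 (x : H) : d x ^ 2 ≤ 2 * γ ^ 2 * ρ + γ ^ 4 / 2 :=
    stepIncrement_sq_le t (norm_direction_le_one _)
  have hd3 (x : H) : |d x| ≤ 1 := (hd1 x).trans (by nlinarith)
  have hdi : Integrable d μ :=
    Integrable.of_bound hdm.aestronglyMeasurable 1 (Filter.Eventually.of_forall hd3)
  have hd2i : Integrable (fun x => d x ^ 2) μ := by
    refine Integrable.of_bound (hdm.pow_const 2).aestronglyMeasurable 1
      (Filter.Eventually.of_forall fun x => ?_)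
    rw [norm_pow, Real.norm_eq_abs]
    exact pow_le_one₀ (abs_nonneg _) (hd3 x)
  -- the mean of the increment
  have hdint : ∫ x, d x ∂μ ≤ -(γ * l * ρ) + γ ^ 2 / 2 := by
    set g := √(1 + ‖t‖ ^ 2) with hg
    have hg1 : 1 ≤ g := one_le_sqrt_one_add_sq ‖t‖
    have hsq : g ^ 2 = 1 + ‖t‖ ^ 2 := Real.sq_sqrt (by positivity)
    have e : ∫ x, d x ∂μ = (2 * γ * inner ℝ (meanDirection μ z) t + γ ^ 2) / (2 * g) := by
      simp only [hd, stepIncrement]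
      rw [integral_div, integral_add
        (((integrable_direction μ z).inner_const t (𝕜 := ℝ)).const_mul _) (integrable_const _),
        integral_const_mul, ← inner_meanDirection]
      simp [hg]
    have h1 := hdrift t
    have h2 : m + t = z := by rw [ht]; abel
    rw [h2, ← hg] at h1
    have h3 : ρ = ‖t‖ ^ 2 / g / g := by rw [hρ, ← hsq, div_div, sq g]
    have h4 : -(γ * l * ρ) + γ ^ 2 / 2 = (-(2 * γ * (l * (‖t‖ ^ 2 / g))) + γ ^ 2 * g) / (2 * g) := by
      rw [h3]; field_simp
    rw [e, h4]
    refine div_le_div_of_nonneg_right ?_ (by positivity)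
    nlinarith [mul_le_mul_of_nonneg_left h1 hγ.le, mul_le_mul_of_nonneg_left hg1 (sq_nonneg γ)]
  have hγ4 : γ ^ 4 ≤ γ ^ 2 := pow_le_pow_of_le_one hγ.le (by linarith) (by norm_num)
  have hγ43 : γ ^ 4 ≤ γ ^ 3 := pow_le_pow_of_le_one hγ.le (by linarith) (by norm_num)
  have hγ32 : γ ^ 3 ≤ γ ^ 2 := pow_le_pow_of_le_one hγ.le (by linarith) (by norm_num)
  have hd2int : ∫ x, d x ^ 2 ∂μ ≤ 2 * γ ^ 2 * ρ + γ ^ 4 / 2 := by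
    refine (integral_mono hd2i (integrable_const _) hd2).trans_eq ?_
    simp
  set w := u + γ with hw
  have hw0 : 0 < w := by positivity
  have hwγ : γ ≤ w := by linarith
  have huw : u ≤ w := by linarith
  set e : H → ℝ := fun x => (1 + u) * (d x + d x ^ 2) with he
  have hei : Integrable e μ := (hdi.add hd2i).const_mul _
  have hesq (x : H) : e x ^ 2 ≤ 20 * γ ^ 2 * (1 + w) * w := by
    have h1 : (d x + d x ^ 2) ^ 2 ≤ 4 * d x ^ 2 := by
      have h2 : d x + d x ^ 2 = d x * (1 + d x) := by ring
      obtain ⟨h3, h4⟩ := abs_le.1 (hd3 x)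
      rw [h2, mul_pow]
      nlinarith [mul_le_mul_of_nonneg_left (by nlinarith : (1 + d x) ^ 2 ≤ 4) (sq_nonneg (d x))]
    have h5 : e x ^ 2 ≤ (1 + u) ^ 2 * (4 * (2 * γ ^ 2 * ρ + γ ^ 4 / 2)) := by
      simp only [he]; rw [mul_pow]
      exact mul_le_mul_of_nonneg_left (h1.trans (by linarith [hd2 x])) (by positivity)
    have h6 : (1 + u) ^ 2 * ρ ≤ (1 + u) * (2 * u) := by
      rw [sq, mul_assoc]; exact mul_le_mul_of_nonneg_left hρ2 (by linarith)
    have h7 := mul_le_mul_of_nonneg_left h6 (by positivity : 0 ≤ 8 * γ ^ 2)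
    have h8 : (1 + u) * u ≤ (1 + w) * w := by gcongr
    have h9 := mul_le_mul_of_nonneg_left h8 (by positivity : 0 ≤ 16 * γ ^ 2)
    have h10 : γ ^ 4 * (1 + u) ^ 2 ≤ 2 * γ ^ 2 * ((1 + w) * w) := by
      have h11 := mul_nonneg (by positivity : 0 ≤ γ ^ 4) (sq_nonneg (1 - u))
      have h12 : γ ^ 2 * γ ≤ γ ^ 2 * w := by gcongr
      have h13 : γ ^ 4 * u ^ 2 ≤ γ ^ 2 * w ^ 2 := by gcongr
      linarith
    calc e x ^ 2 ≤ (1 + u) ^ 2 * (4 * (2 * γ ^ 2 * ρ + γ ^ 4 / 2)) := h5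
      _ = 8 * γ ^ 2 * ((1 + u) ^ 2 * ρ) + 2 * (γ ^ 4 * (1 + u) ^ 2) := by ring
      _ ≤ 8 * γ ^ 2 * ((1 + u) * (2 * u)) + 2 * (2 * γ ^ 2 * ((1 + w) * w)) := by linarith
      _ = 16 * γ ^ 2 * ((1 + u) * u) + 4 * γ ^ 2 * ((1 + w) * w) := by ring
      _ ≤ 16 * γ ^ 2 * ((1 + w) * w) + 4 * γ ^ 2 * ((1 + w) * w) := by linarith
      _ = 20 * γ ^ 2 * (1 + w) * w := by ring
  have heabs (x : H) : |e x| ≤ w := by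
    refine abs_le_of_sq_le_sq ((hesq x).trans ?_) hw0.le
    have h1 : 20 * γ ^ 2 * (1 + w) ≤ w := by
      have h2 : γ ^ 2 ≤ γ / 40 := by nlinarith
      have h3 : γ ^ 2 * (1 + w) ≤ γ / 40 * (1 + w) := by gcongr
      have h4 : γ * w ≤ 1 / 40 * w := by gcongr
      linarith
    rw [sq w]
    exact mul_le_mul_of_nonneg_right h1 hw0.le
  have heint : ∫ x, e x ∂μ ≤ -(γ * l / 8) * w + γ ^ 2 * (1 + l / 8) := by
    simp only [he]
    rw [integral_const_mul, integral_add hdi hd2i]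
    have h1 : ∫ x, d x ∂μ + ∫ x, d x ^ 2 ∂μ ≤ -(γ * l * ρ) / 2 + γ ^ 2 := by
      have : 2 * γ ^ 2 * ρ ≤ γ * l * ρ / 2 := by
        have : 2 * γ * (γ * ρ) ≤ l / 2 * (γ * ρ) := by
          apply mul_le_mul_of_nonneg_right _ (by positivity); linarith
        nlinarith
      linarith
    have h2 := mul_le_mul_of_nonneg_left h1 (by linarith : 0 ≤ 1 + u)
    have h3 := mul_le_mul_of_nonneg_left hρ1 (by positivity : 0 ≤ γ * l)
    have h4 : γ ^ 2 * u ≤ γ * l / 8 * u := by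
      have : γ * γ ≤ γ * (l / 8) := by gcongr
      nlinarith
    have h5 : γ * l * u ≤ γ * l * (2 * ((1 + u) * ρ)) := h3
    calc (1 + u) * (∫ x, d x ∂μ + ∫ x, d x ^ 2 ∂μ) ≤ (1 + u) * (-(γ * l * ρ) / 2 + γ ^ 2) := h2
      _ = -(γ * l * (2 * ((1 + u) * ρ))) / 4 + γ ^ 2 * u + γ ^ 2 := by ring
      _ ≤ -(γ * l * u) / 4 + γ * l / 8 * u + γ ^ 2 := by linarith
      _ = -(γ * l / 8) * w + γ ^ 2 * (1 + l / 8) := by rw [hw]; ring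
  have main := integral_pow_succ_le (f := fun x =>
      potential (z + γ • direction (x - z) - m) + γ) (b := 20 * γ ^ 2 * (1 + w)) hw0
    (by
      have : Measurable fun x => z + γ • direction (x - z) - m :=
        (((measurable_direction.comp (measurable_id.sub_const z)).const_smul γ).const_add z).sub_const m
      exact ((continuous_potential.measurable.comp this).add_const γ).aestronglyMeasurable)
    hei (fun x => add_nonneg (potential_nonneg _) hγ.le)
    (fun x => by
      have h1 := potential_add_le hγ.le (by linarith) t (norm_direction_le_one (x - z))
      have h2 : z + γ • direction (x - z) - m = t + γ • direction (x - z) := by rw [ht]; abel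
      rw [h2]
      simp only [he, hd, hw]
      linarith)
    heabs hesq heint q
  refine main.trans ?_
  have hwq : 0 ≤ w ^ q := by positivity
  have hbr : (q + 1 : ℝ) * (-(γ * l / 8) * w + γ ^ 2 * (1 + l / 8)) +
      Q * (20 * γ ^ 2 * (1 + w)) ≤
      -(l / 16 * γ) * w + ((q + 1) * (1 + l / 8) + Q * 20) * γ ^ 2 := by
    have h1 : (0 : ℝ) ≤ q * (γ * l / 8 * w) := by positivity
    have h2 : Q * (20 * γ ^ 2 * w) ≤ l / 16 * γ * w := by
      have := mul_le_mul_of_nonneg_right hγ3 (by positivity : 0 ≤ γ * w / 16)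
      linarith
    linarith
  have := mul_le_mul_of_nonneg_left hbr hwq
  calc w ^ (q + 1) + w ^ q * ((q + 1) * (-(γ * l / 8) * w + γ ^ 2 * (1 + l / 8)) +
        4 ^ (q + 1) * (20 * γ ^ 2 * (1 + w)))
      ≤ w ^ (q + 1) + w ^ q * (-(l / 16 * γ) * w +
          ((q + 1) * (1 + l / 8) + Q * 20) * γ ^ 2) := by rw [← hQ]; linarith
    _ = _ := by ring

end Potential

/-! ### Independence and recursive inequalities -/

section Independence

variable {Ω E F G : Type*} [MeasurableSpace Ω] [MeasurableSpace E] [MeasurableSpace F]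
  [MeasurableSpace G] {P : Measure Ω}

/-- In a sequence of independent variables, each one is independent of all later ones. -/
theorem ProbabilityTheory.iIndepFun.indepFun_tail {X : ℕ → Ω → E} (hX : ∀ n, Measurable (X n))
    (h : iIndepFun X P) (n : ℕ) : IndepFun (X n) (fun ω k => X (n + 1 + k) ω) P := by
  rw [IndepFun_iff_Indep]
  have h1 := indep_iSup_of_disjoint (fun i => (hX i).comap_le) h
    (Set.disjoint_singleton_left.2 (fun hn : n ∈ Set.Ioi n => lt_irrefl n hn))
  refine indep_of_indep_of_le h1 ?_ ?_
  · simp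
  · rw [MeasurableSpace.comap_process_pi]
    exact iSup_le fun k => le_iSup₂_of_le (n + 1 + k) (by simp; omega) le_rfl

variable [IsProbabilityMeasure P]

theorem ProbabilityTheory.IndepFun.prodMk_of_prodMk {f : Ω → E} {g : Ω → F} {h : Ω → G}
    (hf : Measurable f) (hg : Measurable g) (hh : Measurable h)
    (hfgh : IndepFun f (fun ω => (g ω, h ω)) P) (hgh : IndepFun g h P) :
    IndepFun (fun ω => (f ω, g ω)) h P := by
  have : IsProbabilityMeasure (P.map f) := Measure.isProbabilityMeasure_map hf.aemeasurable
  have : IsProbabilityMeasure (P.map g) := Measure.isProbabilityMeasure_map hg.aemeasurable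
  have : IsProbabilityMeasure (P.map h) := Measure.isProbabilityMeasure_map hh.aemeasurable
  have hfg : IndepFun f g P := hfgh.comp measurable_id measurable_fst
  have h1 := (indepFun_iff_map_prod_eq_prod_map_map hf.aemeasurable
    (hg.prodMk hh).aemeasurable).1 hfgh
  have h2 := (indepFun_iff_map_prod_eq_prod_map_map hg.aemeasurable hh.aemeasurable).1 hgh
  have h3 := (indepFun_iff_map_prod_eq_prod_map_map hf.aemeasurable hg.aemeasurable).1 hfg
  rw [indepFun_iff_map_prod_eq_prod_map_map (hf.prodMk hg).aemeasurable hh.aemeasurable, h3]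
  have h4 := (measurePreserving_prodAssoc (P.map f) (P.map g) (P.map h)).symm.map_eq
  rw [← h4, ← h2, ← h1, Measure.map_map (MeasurableEquiv.measurable _)
    (hf.prodMk (hg.prodMk hh))]
  rfl

/-- Integrate first over the fresh variable, then over the past. -/
theorem integral_le_of_indepFun {S : Ω → E} {Y : Ω → F} (hS : Measurable S) (hY : Measurable Y)
    (h : IndepFun S Y P) {f : E → F → ℝ} (hf : Measurable (Function.uncurry f))
    (hint : Integrable (fun ω => f (S ω) (Y ω)) P) {g : E → ℝ}
    (hg : Integrable (fun ω => g (S ω)) P) (hfg : ∀ s, ∫ y, f s y ∂(P.map Y) ≤ g s) :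
    ∫ ω, f (S ω) (Y ω) ∂P ≤ ∫ ω, g (S ω) ∂P := by
  have : IsProbabilityMeasure (P.map S) := Measure.isProbabilityMeasure_map hS.aemeasurable
  have : IsProbabilityMeasure (P.map Y) := Measure.isProbabilityMeasure_map hY.aemeasurable
  have h1 := (indepFun_iff_map_prod_eq_prod_map_map hS.aemeasurable hY.aemeasurable).1 h
  have h2 : Integrable (Function.uncurry f) ((P.map S).prod (P.map Y)) := by
    rw [← h1, integrable_map_measure hf.aestronglyMeasurable (hS.prodMk hY).aemeasurable]
    exact hint
  have h3 : ∫ ω, f (S ω) (Y ω) ∂P = ∫ s, ∫ y, f s y ∂(P.map Y) ∂(P.map S) := by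
    rw [integral_integral h2, ← h1, integral_map (hS.prodMk hY).aemeasurable
      (hf.aestronglyMeasurable (f := fun z : E × F => f z.1 z.2))]
  have h4 : Integrable (fun s => ∫ y, f s y ∂(P.map Y)) (P.map S) := h2.integral_prod_left
  rw [h3, integral_map hS.aemeasurable h4.aestronglyMeasurable]
  refine integral_mono ?_ hg fun ω => hfg (S ω)
  exact (integrable_map_measure h4.aestronglyMeasurable hS.aemeasurable).1 h4

end Independence

section Recursion

/-- A perturbed contraction with rate `κ γ_n` tracks the size of its perturbation, if this is of
the order of `γ_n ^ (q + 1)`, because `n γ_n` tends to infinity. -/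
theorem exists_le_mul_pow_of_recursion {c α κ C : ℝ} (hc : 0 < c) (hα0 : 0 < α) (hα1 : α < 1)
    (hκ : 0 < κ) (q N : ℕ) {a : ℕ → ℝ}
    (ha : ∀ n, N ≤ n → a (n + 1) ≤ (1 - κ * (c * (n : ℝ) ^ (-α))) * a n +
      C * (c * (n : ℝ) ^ (-α)) ^ (q + 1)) :
    ∃ B : ℝ, 0 ≤ B ∧ ∀ n, 1 ≤ n → a n ≤ B * (c * (n : ℝ) ^ (-α)) ^ q := by
  set γ : ℕ → ℝ := fun n => c * (n : ℝ) ^ (-α) with hγ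
  have hγpos (n : ℕ) (hn : 1 ≤ n) : 0 < γ n := by
    have : (0 : ℝ) < n := by exact_mod_cast hn
    positivity
  have hlim0 : Filter.Tendsto γ Filter.atTop (nhds 0) := by
    have := ((tendsto_rpow_neg_atTop hα0).comp tendsto_natCast_atTop_atTop).const_mul c
    simpa [hγ] using this
  have hlim : Filter.Tendsto (fun n : ℕ => (n : ℝ) ^ (1 - α)) Filter.atTop Filter.atTop :=
    (tendsto_rpow_atTop (by linarith)).comp tendsto_natCast_atTop_atTop
  obtain ⟨N₁, hN₁⟩ := Filter.eventually_atTop.1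
    ((hlim0.eventually_le_const (by positivity : (0 : ℝ) < 1 / κ)).and
      (hlim.eventually_ge_atTop (2 * q / (κ * c))))
  set M := max (max N N₁) 1 with hM
  set B := max (2 * |C| / κ) (∑ k ∈ Finset.Icc 1 M, |a k| / γ k ^ q) with hB
  have hsum (n : ℕ) (hn1 : 1 ≤ n) (hn : n ≤ M) : a n ≤ B * γ n ^ q := by
    have h0 := pow_pos (hγpos n hn1) q
    rw [← div_le_iff₀ h0]
    refine (div_le_div_of_nonneg_right (le_abs_self _) h0.le).trans (le_trans ?_ (le_max_right _ _))
    exact Finset.single_le_sum (f := fun k => |a k| / γ k ^ q)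
      (fun k hk => div_nonneg (abs_nonneg _) (pow_pos (hγpos k (Finset.mem_Icc.1 hk).1) q).le)
      (Finset.mem_Icc.2 ⟨hn1, hn⟩)
  have hB1 : 2 * |C| / κ ≤ B := le_max_left _ _
  have hB0 : 0 ≤ B := le_trans (by positivity) hB1
  have hBC : C ≤ κ / 2 * B := by
    rw [div_le_iff₀ hκ] at hB1
    linarith [le_abs_self C]
  refine ⟨B, hB0, fun n hn => ?_⟩
  rcases le_total n M with h | h
  · exact hsum n hn h
  induction n, h using Nat.le_induction with
  | base => exact hsum M hn le_rfl
  | succ n hMn ih =>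
    have hn1 : 1 ≤ n := (le_max_right _ _).trans hMn
    have hnN : N ≤ n := (le_max_left _ _).trans ((le_max_left _ _).trans hMn)
    obtain ⟨h1, h2⟩ := hN₁ n ((le_max_right _ _).trans ((le_max_left _ _).trans hMn))
    have hg := hγpos n hn1
    have hg' := hγpos (n + 1) (by omega)
    have hn0 : (0 : ℝ) < n := by exact_mod_cast hn1
    have h3 : κ * γ n ≤ 1 := by rw [le_div_iff₀ hκ] at h1; linarith
    have h4 : (q : ℝ) / (n + 1) ≤ κ / 2 * γ n := by
      have e : κ / 2 * γ n = (κ * c / 2 * (n : ℝ) ^ (1 - α)) / n := by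
        simp only [hγ]
        rw [Real.rpow_sub hn0, Real.rpow_one, Real.rpow_neg hn0.le]
        field_simp
      rw [e]
      rw [div_le_iff₀ (by positivity)] at h2
      have : (q : ℝ) ≤ κ * c / 2 * (n : ℝ) ^ (1 - α) := by linarith
      exact (div_le_div_of_nonneg_left (by positivity) hn0 (by linarith)).trans
        (div_le_div_of_nonneg_right this hn0.le)
    -- the ratio of successive steps, by Bernoulli's inequality
    have h5 : (1 - κ / 2 * γ n) * γ n ^ q ≤ γ (n + 1) ^ q := by
      have hr : γ n * (1 - 1 / (n + 1)) ≤ γ (n + 1) := by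
        have e1 : (1 : ℝ) - 1 / (n + 1) = n / (n + 1) := by field_simp; ring
        have e2 : ((n : ℝ) / (n + 1)) ^ (1 : ℝ) ≤ ((n : ℝ) / (n + 1)) ^ α :=
          Real.rpow_le_rpow_of_exponent_ge (by positivity)
            (div_le_one_of_le₀ (by linarith) (by positivity)) hα1.le
        rw [Real.rpow_one] at e2
        rw [e1]
        calc γ n * (n / (n + 1)) ≤ γ n * ((n : ℝ) / (n + 1)) ^ α := by gcongr
          _ = γ (n + 1) := by
            rw [hγ, Real.div_rpow hn0.le (by positivity)]
            simp only [Nat.cast_add, Nat.cast_one]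
            rw [Real.rpow_neg hn0.le, Real.rpow_neg (by positivity)]
            field_simp
      have hb := one_add_mul_le_pow (a := -(1 / ((n : ℝ) + 1))) (by
        have : 1 / ((n : ℝ) + 1) ≤ 1 := div_le_one_of_le₀ (by linarith) (by positivity)
        linarith) q
      have hnn : (0 : ℝ) ≤ 1 - 1 / (n + 1) := by
        have : 1 / ((n : ℝ) + 1) ≤ 1 := div_le_one_of_le₀ (by linarith) (by positivity)
        linarith
      calc (1 - κ / 2 * γ n) * γ n ^ q ≤ (1 + -(1 / ((n : ℝ) + 1))) ^ q * γ n ^ q := by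
            refine mul_le_mul_of_nonneg_right (le_trans ?_ hb) (by positivity)
            have : (q : ℝ) * -(1 / ((n : ℝ) + 1)) = -(q / (n + 1)) := by ring
            rw [this]; linarith
        _ = (γ n * (1 - 1 / (n + 1))) ^ q := by
            rw [mul_pow (γ n), mul_comm, ← sub_eq_add_neg]
        _ ≤ γ (n + 1) ^ q := pow_le_pow_left₀ (mul_nonneg hg.le hnn) hr q
    have h6 := ha n hnN
    have h7 := mul_le_mul_of_nonneg_left (ih hn1) (by linarith : 0 ≤ 1 - κ * γ n)
    have h8 : C * γ n ^ (q + 1) ≤ κ / 2 * B * γ n ^ (q + 1) := by gcongr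
    have h9 := mul_le_mul_of_nonneg_left h5 hB0
    calc a (n + 1) ≤ (1 - κ * γ n) * (B * γ n ^ q) + κ / 2 * B * γ n ^ (q + 1) := by
          exact h6.trans (add_le_add h7 h8)
      _ = B * ((1 - κ / 2 * γ n) * γ n ^ q) := by ring
      _ ≤ B * γ (n + 1) ^ q := h9

/-- Partial sums of increments of the order of `n ^ q` are of the order of `n ^ (q + 1)`. -/
theorem exists_le_mul_pow_succ {a : ℕ → ℝ} {C : ℝ} (q : ℕ)
    (ha : ∀ n, 1 ≤ n → a (n + 1) ≤ a n + C * (n : ℝ) ^ q) :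
    ∃ B : ℝ, 0 ≤ B ∧ ∀ n : ℕ, 1 ≤ n → a n ≤ B * (n : ℝ) ^ (q + 1) := by
  refine ⟨max |a 1| |C|, le_trans (abs_nonneg _) (le_max_left _ _), fun n hn => ?_⟩
  set B := max |a 1| |C|
  have hB0 : 0 ≤ B := le_trans (abs_nonneg _) (le_max_left _ _)
  induction n, hn using Nat.le_induction with
  | base => simpa using (le_abs_self _).trans (le_max_left _ _)
  | succ n hn ih =>
    have hC : C * (n : ℝ) ^ q ≤ B * n ^ q := by
      gcongr; exact (le_abs_self _).trans (le_max_right _ _)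
    have hp : (n : ℝ) ^ q ≤ (n + 1) ^ q := by gcongr; linarith
    calc a (n + 1) ≤ B * (n : ℝ) ^ (q + 1) + B * n ^ q := (ha n hn).trans (add_le_add ih hC)
      _ = B * ((n : ℝ) ^ q * (n + 1)) := by ring
      _ ≤ B * ((n + 1) ^ q * (n + 1)) := by gcongr
      _ = _ := by push_cast; ring

end Recursion

/-! ### Moments of the iterates and of the martingale part -/

section Algorithm

variable {Ω H : Type*} [NormedAddCommGroup H] [InnerProductSpace ℝ H]

theorem robbinsMonro_succ (γ : ℕ → ℝ) (X : ℕ → Ω → H) (Z₁ : Ω → H) {n : ℕ} (hn : 1 ≤ n) (ω : Ω) :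
    robbinsMonro γ X Z₁ (n + 1) ω = robbinsMonro γ X Z₁ n ω +
      γ n • direction (X (n + 1) ω - robbinsMonro γ X Z₁ n ω) := by
  obtain ⟨k, rfl⟩ : ∃ k, n = k + 1 := ⟨n - 1, by omega⟩
  simp only [robbinsMonro, direction, smul_smul, div_eq_mul_inv]

variable [MeasurableSpace H]

/-- The error of the direction that the algorithm follows at time `k`, relative to its conditional
mean: a martingale difference. -/
noncomputable def noise (μ : Measure H) (γ : ℕ → ℝ) (X : ℕ → Ω → H) (Z₁ : Ω → H) (k : ℕ) (ω : Ω) :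
    H :=
  direction (X (k + 1) ω - robbinsMonro γ X Z₁ k ω) - meanDirection μ (robbinsMonro γ X Z₁ k ω)

/-- The martingale part of the algorithm: the sum of the noise at the times `1, …, n - 1`, which is
a function of `Z₁, X 2, …, X n`. -/
noncomputable def noiseSum (μ : Measure H) (γ : ℕ → ℝ) (X : ℕ → Ω → H) (Z₁ : Ω → H) (n : ℕ)
    (ω : Ω) : H :=
  ∑ k ∈ Finset.Ico 1 n, noise μ γ X Z₁ k ω

theorem noiseSum_succ (μ : Measure H) (γ : ℕ → ℝ) (X : ℕ → Ω → H) (Z₁ : Ω → H) {n : ℕ}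
    (hn : 1 ≤ n) (ω : Ω) :
    noiseSum μ γ X Z₁ (n + 1) ω = noiseSum μ γ X Z₁ n ω + noise μ γ X Z₁ n ω := by
  rw [noiseSum, Finset.sum_Ico_succ_top hn, noiseSum]

section NoiseBound

variable [SecondCountableTopology H] [BorelSpace H]

theorem norm_noise_le (μ : Measure H) [IsProbabilityMeasure μ] (γ : ℕ → ℝ) (X : ℕ → Ω → H) (Z₁ : Ω → H) (k : ℕ)
    (ω : Ω) : ‖noise μ γ X Z₁ k ω‖ ≤ 2 := by
  refine (norm_sub_le _ _).trans ?_
  linarith [norm_direction_le_one (X (k + 1) ω - robbinsMonro γ X Z₁ k ω),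
    norm_meanDirection_le_one μ (robbinsMonro γ X Z₁ k ω)]

theorem norm_noiseSum_le (μ : Measure H) [IsProbabilityMeasure μ] (γ : ℕ → ℝ)
    (X : ℕ → Ω → H) (Z₁ : Ω → H) (n : ℕ) (ω : Ω) :
    ‖noiseSum μ γ X Z₁ n ω‖ ≤ n * 2 := by
  refine (norm_sum_le_of_le _ fun k _ => norm_noise_le μ γ X Z₁ k ω).trans ?_
  rw [Finset.sum_const, Nat.card_Ico, nsmul_eq_mul]
  gcongr
  exact_mod_cast Nat.sub_le n 1

end NoiseBound

variable [MeasurableSpace Ω]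

/-- The random input of the algorithm: a sample `X 1, X 2, …` from `μ`, and a bounded starting
value that is independent of `X 2, X 3, …`. -/
structure IsSample (P : Measure Ω) (μ : Measure H) (X : ℕ → Ω → H) (Z₁ : Ω → H) : Prop where
  measurable : ∀ n, 1 ≤ n → Measurable (X n)
  map_eq : ∀ n, 1 ≤ n → P.map (X n) = μ
  indep : iIndepFun (fun n => X (n + 1)) P
  measurable_init : Measurable Z₁
  bdd_init : ∃ M : ℝ, ∀ᵐ ω ∂P, ‖Z₁ ω‖ ≤ M
  indep_init : IndepFun Z₁ (fun ω (n : ℕ) => X (n + 2) ω) P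

theorem integrable_of_bounded_on_balls {E : Type*} [NormedAddCommGroup E] [MeasurableSpace E]
    {P : Measure Ω} [IsFiniteMeasure P] {S : Ω → E} (hS : Measurable S)
    (hbdd : ∃ R : ℝ, ∀ᵐ ω ∂P, ‖S ω‖ ≤ R) {f : E → ℝ} (hf : Measurable f)
    (hb : ∀ R : ℝ, ∃ b : ℝ, ∀ z, ‖z‖ ≤ R → |f z| ≤ b) : Integrable (fun ω => f (S ω)) P := by
  obtain ⟨R, hR⟩ := hbdd
  obtain ⟨b, hb⟩ := hb R
  exact Integrable.of_bound (hf.comp hS).aestronglyMeasurable b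
    (hR.mono fun ω hω => hb _ hω)

variable {P : Measure Ω} {μ : Measure H} {X : ℕ → Ω → H} {Z₁ : Ω → H}

namespace IsSample

theorem bdd_robbinsMonro (h : IsSample P μ X Z₁) (γ : ℕ → ℝ) {n : ℕ} (hn : 1 ≤ n) :
    ∃ R : ℝ, ∀ᵐ ω ∂P, ‖robbinsMonro γ X Z₁ n ω‖ ≤ R := by
  induction n, hn using Nat.le_induction with
  | base => exact h.bdd_init
  | succ n hn ih =>
    obtain ⟨R, hR⟩ := ih
    refine ⟨R + |γ n|, hR.mono fun ω hω => ?_⟩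
    rw [robbinsMonro_succ γ X Z₁ hn]
    refine (norm_add_le _ _).trans (add_le_add hω ?_)
    rw [norm_smul, Real.norm_eq_abs]
    exact mul_le_of_le_one_right (abs_nonneg _) (norm_direction_le_one _)

variable [SecondCountableTopology H] [BorelSpace H]

theorem measurable_robbinsMonro (h : IsSample P μ X Z₁) (γ : ℕ → ℝ) {n : ℕ} (hn : 1 ≤ n) :
    Measurable (robbinsMonro γ X Z₁ n) := by
  induction n, hn using Nat.le_induction with
  | base => exact h.measurable_init
  | succ n hn ih =>
    have e : robbinsMonro γ X Z₁ (n + 1) = fun ω => robbinsMonro γ X Z₁ n ω +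
      γ n • direction (X (n + 1) ω - robbinsMonro γ X Z₁ n ω) :=
      funext (robbinsMonro_succ γ X Z₁ hn)
    rw [e]
    exact ih.add ((measurable_direction.comp
      ((h.measurable (n + 1) (by omega)).sub ih)).const_smul (γ n))

theorem integrable_potential_pow [IsFiniteMeasure P] (h : IsSample P μ X Z₁) (γ : ℕ → ℝ) {n : ℕ} (hn : 1 ≤ n) (m : H)
    {g : ℝ} (hg : 0 ≤ g) (q : ℕ) :
    Integrable (fun ω => (potential (robbinsMonro γ X Z₁ n ω - m) + g) ^ q) P := by
  refine integrable_of_bounded_on_balls (h.measurable_robbinsMonro γ hn) (h.bdd_robbinsMonro γ hn)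
    (f := fun z => (potential (z - m) + g) ^ q) ?_ fun R => ?_
  · have := (continuous_potential (H := H)).measurable
    exact ((this.comp (measurable_id.sub_const m)).add_const g).pow_const q
  · refine ⟨(Real.exp (√(1 + (R + ‖m‖) ^ 2) - 1) - 1 + g) ^ q, fun z hz => ?_⟩
    have h0 := potential_nonneg (z - m)
    rw [abs_of_nonneg (pow_nonneg (by linarith) q)]
    have h1 : ‖z - m‖ ≤ R + ‖m‖ := (norm_sub_le _ _).trans (by linarith)
    have h2 : potential (z - m) ≤ Real.exp (√(1 + (R + ‖m‖) ^ 2) - 1) - 1 := by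
      unfold potential; gcongr
    gcongr

end IsSample

variable [SecondCountableTopology H] [BorelSpace H] [IsProbabilityMeasure μ]

namespace IsSample

theorem measurable_noise (h : IsSample P μ X Z₁) (γ : ℕ → ℝ) {n : ℕ} (hn : 1 ≤ n) :
    Measurable (noise μ γ X Z₁ n) :=
  (measurable_direction.comp
    ((h.measurable (n + 1) (by omega)).sub (h.measurable_robbinsMonro γ hn))).sub
    ((stronglyMeasurable_meanDirection μ).measurable.comp (h.measurable_robbinsMonro γ hn))

theorem measurable_noiseSum (h : IsSample P μ X Z₁) (γ : ℕ → ℝ) (n : ℕ) :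
    Measurable (noiseSum μ γ X Z₁ n) := by
  unfold noiseSum
  exact Finset.measurable_fun_sum _ fun k hk => h.measurable_noise γ (Finset.mem_Ico.1 hk).1

variable [IsProbabilityMeasure P]

/-- The state of the algorithm at time `n` is independent of the later observations. -/
theorem indepFun_tail (h : IsSample P μ X Z₁) (γ : ℕ → ℝ) {n : ℕ} (hn : 1 ≤ n) :
    IndepFun (fun ω => (robbinsMonro γ X Z₁ n ω, noiseSum μ γ X Z₁ n ω))
      (fun ω (k : ℕ) => X (n + 1 + k) ω) P := by
  induction n, hn using Nat.le_induction with
  | base =>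
    have e : (fun ω => (robbinsMonro γ X Z₁ 1 ω, noiseSum μ γ X Z₁ 1 ω)) =
        (fun z : H => (z, (0 : H))) ∘ Z₁ := by
      ext ω <;> simp [robbinsMonro, noiseSum]
    have e2 : (fun ω (k : ℕ) => X (1 + 1 + k) ω) = fun ω (k : ℕ) => X (k + 2) ω := by
      ext ω k; congr 1; omega
    rw [e, e2]
    exact h.indep_init.comp (by fun_prop) measurable_id
  | succ n hn ih =>
    set S := fun ω => (robbinsMonro γ X Z₁ n ω, noiseSum μ γ X Z₁ n ω)
    have hSm : Measurable S := (h.measurable_robbinsMonro γ hn).prodMk (h.measurable_noiseSum γ n)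
    have hXm : Measurable (X (n + 1)) := h.measurable _ (by omega)
    have hTm : Measurable (fun ω (k : ℕ) => X (n + 1 + 1 + k) ω) :=
      measurable_pi_lambda _ fun k => h.measurable _ (by omega)
    have h1 : IndepFun S (fun ω => (X (n + 1) ω, fun k : ℕ => X (n + 1 + 1 + k) ω)) P := by
      have hφ : Measurable (fun x : ℕ → H => (x 0, fun k : ℕ => x (1 + k))) :=
        (measurable_pi_apply 0).prodMk (measurable_pi_lambda _ fun k => measurable_pi_apply _)
      have := ih.comp measurable_id hφ
      have e : (fun ω => (X (n + 1) ω, fun k : ℕ => X (n + 1 + 1 + k) ω)) =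
          (fun x : ℕ → H => (x 0, fun k : ℕ => x (1 + k))) ∘
            (fun ω (k : ℕ) => X (n + 1 + k) ω) := by
        ext ω k
        · rfl
        · simp only [Function.comp_apply, add_assoc]
      rw [e]
      exact this
    have h2 : IndepFun (X (n + 1)) (fun ω (k : ℕ) => X (n + 1 + 1 + k) ω) P := by
      have := h.indep.indepFun_tail (fun k => h.measurable _ (by omega)) n
      have e : (fun ω (k : ℕ) => X (n + 1 + 1 + k) ω) = fun ω (k : ℕ) => X (n + 1 + k + 1) ω := by
        ext ω k; congr 1; omega
      rw [e]; exact this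
    have h3 := IndepFun.prodMk_of_prodMk hSm hXm hTm h1 h2
    have hφ : Measurable (fun s : (H × H) × H => (s.1.1 + γ n • direction (s.2 - s.1.1),
        s.1.2 + (direction (s.2 - s.1.1) - meanDirection μ s.1.1))) := by
      have hd : Measurable (fun s : (H × H) × H => direction (s.2 - s.1.1)) :=
        measurable_direction.comp (by fun_prop)
      have hm : Measurable (fun s : (H × H) × H => meanDirection μ s.1.1) :=
        (stronglyMeasurable_meanDirection μ).measurable.comp (by fun_prop)
      fun_prop
    have e : (fun ω => (robbinsMonro γ X Z₁ (n + 1) ω, noiseSum μ γ X Z₁ (n + 1) ω)) =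
        (fun s : (H × H) × H => (s.1.1 + γ n • direction (s.2 - s.1.1),
          s.1.2 + (direction (s.2 - s.1.1) - meanDirection μ s.1.1))) ∘
          (fun ω => (S ω, X (n + 1) ω)) := by
      ext ω
      · simp only [robbinsMonro_succ γ X Z₁ hn, Function.comp_apply, S]
      · simp only [noiseSum_succ μ γ X Z₁ hn, Function.comp_apply, S, noise]
    rw [e]
    exact h3.comp hφ measurable_id

theorem indepFun_next (h : IsSample P μ X Z₁) (γ : ℕ → ℝ) {n : ℕ} (hn : 1 ≤ n) :
    IndepFun (fun ω => (robbinsMonro γ X Z₁ n ω, noiseSum μ γ X Z₁ n ω)) (X (n + 1)) P :=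
  (h.indepFun_tail γ hn).comp measurable_id (measurable_pi_apply 0)

/-- The moments of the potential have the order of the powers of the step `γ_n`. -/
theorem exists_integral_potential_pow_le [CompleteSpace H] (h : IsSample P μ X Z₁) {m : H} {l : ℝ}
    (hl : 0 < l)
    (hdrift : ∀ t : H, l * (‖t‖ ^ 2 / √(1 + ‖t‖ ^ 2)) ≤ -inner ℝ (meanDirection μ (m + t)) t)
    {c α : ℝ} (hc : 0 < c) (hα0 : 0 < α) (hα1 : α < 1) (q : ℕ) :
    ∃ B : ℝ, 0 ≤ B ∧ ∀ n, 1 ≤ n →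
      ∫ ω, (potential (robbinsMonro (fun k : ℕ => c * (k : ℝ) ^ (-α)) X Z₁ n ω - m) +
        c * (n : ℝ) ^ (-α)) ^ q ∂P ≤ B * (c * (n : ℝ) ^ (-α)) ^ q := by
  set γ : ℕ → ℝ := fun k => c * (k : ℝ) ^ (-α) with hγ
  induction q with
  | zero => exact ⟨1, zero_le_one, fun n _ => by simp⟩
  | succ q ih =>
    obtain ⟨B, hB0, hB⟩ := ih
    obtain ⟨γ₀, C, hγ₀, hC, hstep⟩ := _root_.exists_integral_potential_pow_le hl hdrift q
    have hlim0 : Filter.Tendsto γ Filter.atTop (nhds 0) := by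
      have := ((tendsto_rpow_neg_atTop hα0).comp tendsto_natCast_atTop_atTop).const_mul c
      simpa [hγ] using this
    obtain ⟨N, hN⟩ := Filter.eventually_atTop.1
      ((hlim0.eventually_le_const hγ₀).and (Filter.eventually_ge_atTop 1))
    refine exists_le_mul_pow_of_recursion (κ := l / 16) (C := C * B) hc hα0 hα1 (by positivity)
      (q + 1) N fun n hn => ?_
    obtain ⟨hn0, hn1⟩ := hN n hn
    have hnpos : (0 : ℝ) < n := by exact_mod_cast hn1
    have hγn : 0 < γ n := by positivity
    have hmono : γ (n + 1) ≤ γ n := by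
      simp only [hγ]
      refine mul_le_mul_of_nonneg_left (Real.rpow_le_rpow_of_nonpos hnpos ?_ (by linarith)) hc.le
      push_cast; linarith
    have hmono0 : 0 ≤ γ (n + 1) := by positivity
    have hind : IndepFun (robbinsMonro γ X Z₁ n) (X (n + 1)) P :=
      (h.indepFun_next γ hn1).comp measurable_fst measurable_id
    have h1 : ∫ ω, (potential (robbinsMonro γ X Z₁ (n + 1) ω - m) + γ (n + 1)) ^ (q + 1) ∂P ≤
        ∫ ω, (potential (robbinsMonro γ X Z₁ n ω + γ n •
          direction (X (n + 1) ω - robbinsMonro γ X Z₁ n ω) - m) + γ n) ^ (q + 1) ∂P := by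
      have i1 := h.integrable_potential_pow γ (by omega : 1 ≤ n + 1) m hmono0 (q + 1)
      have i2 := h.integrable_potential_pow γ (by omega : 1 ≤ n + 1) m hγn.le (q + 1)
      simp only [robbinsMonro_succ γ X Z₁ hn1] at i1 i2 ⊢
      refine integral_mono i1 i2 fun ω => ?_
      have := potential_nonneg (robbinsMonro γ X Z₁ n ω + γ n •
          direction (X (n + 1) ω - robbinsMonro γ X Z₁ n ω) - m)
      dsimp only
      gcongr
    have i3 := h.integrable_potential_pow γ hn1 m hγn.le (q + 1)
    have i4 := h.integrable_potential_pow γ hn1 m hγn.le q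
    have h2 := integral_le_of_indepFun (h.measurable_robbinsMonro γ hn1)
      (h.measurable (n + 1) (by omega)) hind
      (f := fun z x => (potential (z + γ n • direction (x - z) - m) + γ n) ^ (q + 1))
      (g := fun z => (1 - l / 16 * γ n) * (potential (z - m) + γ n) ^ (q + 1) +
          C * γ n ^ 2 * (potential (z - m) + γ n) ^ q)
      (by
        have hp := (continuous_potential (H := H)).measurable
        have hd : Measurable (fun z : H × H => direction (z.2 - z.1)) :=
          measurable_direction.comp (by fun_prop)
        exact ((hp.comp ((measurable_fst.add (hd.const_smul (γ n))).sub_const m)).add_const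
          (γ n)).pow_const (q + 1))
      (by
        have i2 := h.integrable_potential_pow γ (by omega : 1 ≤ n + 1) m hγn.le (q + 1)
        simp only [robbinsMonro_succ γ X Z₁ hn1] at i2
        exact i2)
      ((i3.const_mul _).add (i4.const_mul _))
      (by
        rw [h.map_eq (n + 1) (by omega)]
        exact hstep (γ n) hγn hn0)
    rw [integral_add (i3.const_mul _) (i4.const_mul _), integral_const_mul,
      integral_const_mul] at h2
    refine h1.trans (h2.trans (add_le_add le_rfl ?_))
    calc _ ≤ C * γ n ^ 2 * (B * γ n ^ q) := by gcongr; exact hB n hn1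
      _ = _ := by ring

/-- The iterates converge to `m` at the rate `√γ_n`, in every `L^q`. -/
theorem exists_integral_norm_sub_pow_le [CompleteSpace H] (h : IsSample P μ X Z₁) {m : H} {l : ℝ}
    (hl : 0 < l)
    (hdrift : ∀ t : H, l * (‖t‖ ^ 2 / √(1 + ‖t‖ ^ 2)) ≤ -inner ℝ (meanDirection μ (m + t)) t)
    {c α : ℝ} (hc : 0 < c) (hα0 : 0 < α) (hα1 : α < 1) (q : ℕ) :
    ∃ B : ℝ, 0 ≤ B ∧ ∀ n, 1 ≤ n →
      ∫ ω, ‖robbinsMonro (fun k : ℕ => c * (k : ℝ) ^ (-α)) X Z₁ n ω - m‖ ^ (2 * q) ∂P ≤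
        B * ((n : ℝ) ^ (-α)) ^ q := by
  obtain ⟨B, hB0, hB⟩ := h.exists_integral_potential_pow_le hl hdrift hc hα0 hα1 q
  refine ⟨2 ^ q * (B * c ^ q), by positivity, fun n hn => ?_⟩
  set γ : ℕ → ℝ := fun k => c * (k : ℝ) ^ (-α) with hγ
  have hγn : 0 ≤ c * (n : ℝ) ^ (-α) := by positivity
  have i := h.integrable_potential_pow γ hn m hγn q
  calc ∫ ω, ‖robbinsMonro γ X Z₁ n ω - m‖ ^ (2 * q) ∂P
      ≤ ∫ ω, 2 ^ q * (potential (robbinsMonro γ X Z₁ n ω - m) + c * (n : ℝ) ^ (-α)) ^ q ∂P := by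
        refine integral_mono_of_nonneg (Filter.Eventually.of_forall fun ω => by positivity)
          (i.const_mul _) (Filter.Eventually.of_forall fun ω => ?_)
        dsimp only
        rw [pow_mul, ← mul_pow]
        refine pow_le_pow_left₀ (sq_nonneg _) ?_ q
        linarith [norm_sq_le_potential (robbinsMonro γ X Z₁ n ω - m)]
    _ = 2 ^ q * ∫ ω, (potential (robbinsMonro γ X Z₁ n ω - m) + c * (n : ℝ) ^ (-α)) ^ q ∂P :=
        integral_const_mul _ _
    _ ≤ 2 ^ q * (B * (c * (n : ℝ) ^ (-α)) ^ q) := by gcongr; exact hB n hn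
    _ = _ := by rw [mul_pow]; ring

theorem integrable_noiseSum_pow (h : IsSample P μ X Z₁) (γ : ℕ → ℝ) (n q : ℕ) :
    Integrable (fun ω => (‖noiseSum μ γ X Z₁ n ω‖ ^ 2 + 32) ^ q) P := by
  refine integrable_of_bounded_on_balls (h.measurable_noiseSum γ n)
    ⟨n * 2, Filter.Eventually.of_forall (norm_noiseSum_le μ γ X Z₁ n)⟩
    (f := fun z => (‖z‖ ^ 2 + 32) ^ q) (by fun_prop) fun R => ⟨(R ^ 2 + 32) ^ q, fun z hz => ?_⟩
  rw [abs_of_nonneg (by positivity)]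
  gcongr

/-- The moments of the martingale part grow like those of a sum of independent variables. The
summand `32` makes the square of each increment relatively small. -/
theorem exists_integral_noiseSum_pow_le [CompleteSpace H] (h : IsSample P μ X Z₁) (γ : ℕ → ℝ)
    (q : ℕ) :
    ∃ B : ℝ, 0 ≤ B ∧ ∀ n, 1 ≤ n →
      ∫ ω, (‖noiseSum μ γ X Z₁ n ω‖ ^ 2 + 32) ^ q ∂P ≤ B * (n : ℝ) ^ q := by
  induction q with
  | zero => exact ⟨1, zero_le_one, fun n _ => by simp⟩
  | succ q ih =>
    obtain ⟨B, hB0, hB⟩ := ih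
    set K : ℝ := (q + 1) * 4 + 4 ^ (q + 1) * 32 with hK
    refine exists_le_mul_pow_succ (C := K * B) q fun n hn => ?_
    have i1 := h.integrable_noiseSum_pow γ n (q + 1)
    have i2 := h.integrable_noiseSum_pow γ n q
    set f : H × H → H → ℝ := fun s x =>
      (‖s.2 + (direction (x - s.1) - meanDirection μ s.1)‖ ^ 2 + 32) ^ (q + 1) with hf
    have hd : Measurable (fun s : (H × H) × H => direction (s.2 - s.1.1)) :=
      measurable_direction.comp (by fun_prop)
    have hm : Measurable (fun s : (H × H) × H => meanDirection μ s.1.1) :=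
      (stronglyMeasurable_meanDirection μ).measurable.comp (by fun_prop)
    have h2 := integral_le_of_indepFun
      ((h.measurable_robbinsMonro γ hn).prodMk (h.measurable_noiseSum γ n))
      (h.measurable (n + 1) (by omega)) (h.indepFun_next γ hn) (f := f)
      (g := fun s => (‖s.2‖ ^ 2 + 32) ^ (q + 1) + (‖s.2‖ ^ 2 + 32) ^ q * K)
      (by
        simp only [hf, Function.uncurry_def]
        fun_prop)
      (by
        have i3 := h.integrable_noiseSum_pow γ (n + 1) (q + 1)
        simp only [noiseSum_succ μ γ X Z₁ hn, noise] at i3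
        exact i3)
      (i1.add (i2.mul_const _))
      (by
        rw [h.map_eq (n + 1) (by omega)]
        rintro ⟨z, M⟩
        have idir := integrable_direction μ z
        set ν : H → H := fun x => direction (x - z) - meanDirection μ z with hν
        have hνi : Integrable ν μ := idir.sub (integrable_const _)
        have hν0 : ∫ x, ν x ∂μ = 0 := by
          simp only [hν]
          rw [integral_sub idir (integrable_const _)]
          simp [meanDirection]
        have hν2 (x : H) : ‖ν x‖ ≤ 2 := (norm_sub_le _ _).trans (by
          linarith [norm_direction_le_one (x - z), norm_meanDirection_le_one μ z])
        have hin (x : H) : |(inner ℝ M (ν x) : ℝ)| ≤ 2 * ‖M‖ := by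
          refine (abs_real_inner_le_norm _ _).trans ?_
          nlinarith [mul_le_mul_of_nonneg_left (hν2 x) (norm_nonneg M)]
        have hinsq (x : H) : (inner ℝ M (ν x) : ℝ) ^ 2 ≤ 4 * ‖M‖ ^ 2 := by
          rw [← sq_abs]; nlinarith [hin x, abs_nonneg (inner ℝ M (ν x) : ℝ)]
        have hesq (x : H) : (2 * inner ℝ M (ν x) + 4 : ℝ) ^ 2 ≤ 32 * (‖M‖ ^ 2 + 32) := by
          nlinarith [hinsq x, sq_nonneg (2 * inner ℝ M (ν x) - 4 : ℝ)]
        have hei : Integrable (fun x => (2 * inner ℝ M (ν x) + 4 : ℝ)) μ :=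
          ((hνi.const_inner M (𝕜 := ℝ)).const_mul 2).add (integrable_const _)
        exact integral_pow_succ_le (w := ‖M‖ ^ 2 + 32) (a := 4) (b := 32)
          (e := fun x => 2 * inner ℝ M (ν x) + 4) (f := fun x => ‖M + ν x‖ ^ 2 + 32)
          (by positivity)
          (((aestronglyMeasurable_const.add hνi.1).norm.pow 2).add aestronglyMeasurable_const)
          hei (fun x => by positivity)
          (fun x => by
            rw [norm_add_sq_real]
            nlinarith [hν2 x, norm_nonneg (ν x)])
          (fun x => abs_le_of_sq_le_sq ((hesq x).trans (by nlinarith [sq_nonneg ‖M‖]))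
            (by positivity))
          hesq
          (by
            rw [integral_add ((hνi.const_inner M (𝕜 := ℝ)).const_mul 2) (integrable_const _),
              integral_const_mul, integral_inner hνi, hν0]
            simp) q)
    rw [integral_add i1 (i2.mul_const _), integral_mul_const] at h2
    have e : ∫ ω, (‖noiseSum μ γ X Z₁ (n + 1) ω‖ ^ 2 + 32) ^ (q + 1) ∂P =
        ∫ ω, f (robbinsMonro γ X Z₁ n ω, noiseSum μ γ X Z₁ n ω) (X (n + 1) ω) ∂P := by
      simp only [noiseSum_succ μ γ X Z₁ hn, noise, hf]
    rw [e]
    refine h2.trans (add_le_add le_rfl ?_)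
    calc _ ≤ B * (n : ℝ) ^ q * K := by gcongr; exact hB n hn
      _ = _ := by ring

end IsSample

end Algorithm

/-! ### The averages -/

section Averaging

theorem eLpNorm_le_ofReal_iff {Ω E : Type*} [MeasurableSpace Ω] [NormedAddCommGroup E]
    {P : Measure Ω} {f : Ω → E} {q : ℕ} (hq : q ≠ 0) (hf : MemLp f q P) {b : ℝ} (hb : 0 ≤ b) :
    eLpNorm f q P ≤ ENNReal.ofReal b ↔ ∫ ω, ‖f ω‖ ^ q ∂P ≤ b ^ q := by
  have h0 : 0 ≤ ∫ ω, ‖f ω‖ ^ q ∂P := integral_nonneg fun ω => by positivity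
  rw [hf.eLpNorm_eq_integral_rpow_norm (by exact_mod_cast hq) (ENNReal.natCast_ne_top q),
    ENNReal.ofReal_le_ofReal_iff hb]
  simp only [ENNReal.toReal_natCast, Real.rpow_natCast]
  rw [Real.rpow_inv_le_iff_of_pos h0 hb (by positivity), Real.rpow_natCast]

theorem sum_inv_sqrt_le (n : ℕ) : ∑ k ∈ Finset.Icc 1 n, (√(k : ℝ))⁻¹ ≤ 2 * √(n : ℝ) := by
  induction n with
  | zero => simp
  | succ n ih =>
    rw [Finset.sum_Icc_succ_top (by omega)]
    have h1 : √(n : ℝ) ^ 2 = n := Real.sq_sqrt (by positivity)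
    have h2 : √((n + 1 : ℕ) : ℝ) ^ 2 = n + 1 := by
      rw [Real.sq_sqrt (by positivity)]; push_cast; ring
    have h3 : 0 < √((n + 1 : ℕ) : ℝ) := Real.sqrt_pos.2 (by positivity)
    have h4 : (√((n + 1 : ℕ) : ℝ))⁻¹ ≤ 2 * √((n + 1 : ℕ) : ℝ) - 2 * √(n : ℝ) := by
      rw [inv_le_iff_one_le_mul₀ h3]
      nlinarith [sq_nonneg (√((n + 1 : ℕ) : ℝ) - √(n : ℝ))]
    linarith

/-- The inverse steps grow slowly. -/
theorem rpow_add_one_sub_rpow_mul_le {α x : ℝ} (hα0 : 0 < α) (hα1 : α < 1) (hx : 1 ≤ x) :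
    ((x + 1) ^ α - x ^ α) * (x + 1) ^ (-(α / 2)) ≤ (√x)⁻¹ := by
  have hx0 : 0 < x := by linarith
  have h1 : (x + 1) ^ α - x ^ α ≤ x ^ (α - 1) := by
    have e : x + 1 = x * (1 + x⁻¹) := by field_simp
    have h2 : (1 + x⁻¹) ^ α ≤ (1 + x⁻¹) ^ (1 : ℝ) :=
      Real.rpow_le_rpow_of_exponent_le (by have := inv_pos.2 hx0; linarith) hα1.le
    rw [Real.rpow_one] at h2
    rw [e, Real.mul_rpow hx0.le (by positivity), Real.rpow_sub hx0, Real.rpow_one]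
    have h3 := mul_le_mul_of_nonneg_left h2 (Real.rpow_nonneg hx0.le α)
    rw [div_eq_mul_inv]
    linarith
  have h4 : (x + 1) ^ (-(α / 2)) ≤ x ^ (-(α / 2)) :=
    Real.rpow_le_rpow_of_nonpos hx0 (by linarith) (by linarith)
  calc ((x + 1) ^ α - x ^ α) * (x + 1) ^ (-(α / 2)) ≤ x ^ (α - 1) * x ^ (-(α / 2)) := by
        gcongr
    _ = x ^ (α - 1 + -(α / 2)) := (Real.rpow_add hx0 _ _).symm
    _ ≤ x ^ (-(1 / 2) : ℝ) := Real.rpow_le_rpow_of_exponent_le hx (by linarith)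
    _ = (√x)⁻¹ := by rw [Real.rpow_neg hx0.le, Real.sqrt_eq_rpow]

variable {Ω H : Type*} [NormedAddCommGroup H] [InnerProductSpace ℝ H] [MeasurableSpace H]

variable [SecondCountableTopology H] [BorelSpace H]

/-- Summation by parts in the linearized recursion. -/
theorem sum_hessian_eq {μ : Measure H} {m : H} (hw : Integrable (fun x => ‖x - m‖⁻¹) μ)
    {γ : ℕ → ℝ} (hγ : ∀ n, 1 ≤ n → γ n ≠ 0) (X : ℕ → Ω → H) (Z₁ : Ω → H) (n : ℕ) (ω : Ω) :
    ∑ k ∈ Finset.Icc 1 n, hessian hw (robbinsMonro γ X Z₁ k ω - m) =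
      ∑ k ∈ Finset.Icc 1 n,
        ((meanDirection μ (robbinsMonro γ X Z₁ k ω) + hessian hw (robbinsMonro γ X Z₁ k ω - m)) +
          ((γ (k + 1))⁻¹ - (γ k)⁻¹) • (robbinsMonro γ X Z₁ (k + 1) ω - m)) +
      (noiseSum μ γ X Z₁ (n + 1) ω + (γ 1)⁻¹ • (robbinsMonro γ X Z₁ 1 ω - m) -
        (γ (n + 1))⁻¹ • (robbinsMonro γ X Z₁ (n + 1) ω - m)) := by
  induction n with
  | zero => simp [noiseSum]
  | succ n ih =>
    rw [Finset.sum_Icc_succ_top (by omega), Finset.sum_Icc_succ_top (by omega), ih,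
      noiseSum_succ μ γ X Z₁ (by omega : 1 ≤ n + 1), noise,
      robbinsMonro_succ γ X Z₁ (by omega : 1 ≤ n + 1)]
    have h1 := hγ (n + 1) (by omega)
    match_scalars <;> field_simp <;> ring

variable [CompleteSpace H] [MeasurableSpace Ω] {P : Measure Ω} [IsProbabilityMeasure P]
  {μ : Measure H} [IsProbabilityMeasure μ] {X : ℕ → Ω → H} {Z₁ : Ω → H}

/-- The averages have the rate `n ^ (-1 / 2)` in every `L^(2 p)`, given the linearization of
the mean direction at `m`, the coercivity of the Hessian and the global drift. -/
theorem IsSample.exists_integral_averaged_pow_le (h : IsSample P μ X Z₁) {m : H}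
    (hw : Integrable (fun x => ‖x - m‖⁻¹) μ) {κ K l : ℝ} (hκ : 0 < κ) (hK : 0 ≤ K) (hl : 0 < l)
    (hcoer : ∀ v : H, κ * ‖v‖ ^ 2 ≤ inner ℝ (hessian hw v) v)
    (htaylor : ∀ t : H, ‖meanDirection μ (m + t) + hessian hw t‖ ≤ K * ‖t‖ ^ 2)
    (hdrift : ∀ t : H, l * (‖t‖ ^ 2 / √(1 + ‖t‖ ^ 2)) ≤ -inner ℝ (meanDirection μ (m + t)) t)
    {c α : ℝ} (hc : 0 < c) (hα : 1 / 2 < α) (hα1 : α < 1) {p : ℕ} (hp : 1 ≤ p) :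
    ∃ A : ℝ, 0 < A ∧ ∀ n : ℕ, 1 ≤ n →
      Integrable (fun ω =>
        ‖averaged (robbinsMonro (fun k : ℕ => c * (k : ℝ) ^ (-α)) X Z₁) n ω - m‖ ^ (2 * p)) P ∧
      ∫ ω, ‖averaged (robbinsMonro (fun k : ℕ => c * (k : ℝ) ^ (-α)) X Z₁) n ω - m‖ ^ (2 * p) ∂P
        ≤ A / (n : ℝ) ^ p := by
  have hα0 : 0 < α := by linarith
  obtain ⟨B₁, hB₁0, hB₁⟩ := h.exists_integral_norm_sub_pow_le hl hdrift hc hα0 hα1 p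
  obtain ⟨B₂, hB₂0, hB₂⟩ := h.exists_integral_norm_sub_pow_le hl hdrift hc hα0 hα1 (2 * p)
  set γ : ℕ → ℝ := fun k => c * (k : ℝ) ^ (-α) with hγ
  obtain ⟨B₃, hB₃0, hB₃⟩ := h.exists_integral_noiseSum_pow_le γ p
  set Z := robbinsMonro γ X Z₁ with hZ
  have h2p : 2 * p ≠ 0 := by omega
  have hone : (1 : ℝ≥0∞) ≤ ((2 * p : ℕ) : ℝ≥0∞) := by exact_mod_cast (by omega : 1 ≤ 2 * p)
  -- a constant whose `2 p`-th power dominates all three moment constants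
  set b := 1 + B₁ + B₂ + B₃ with hb
  have hb1 : 1 ≤ b := by linarith
  have hbp : b ≤ b ^ (2 * p) := le_self_pow₀ hb1 h2p
  have hb0 : 0 ≤ b := by linarith
  have hZm (k : ℕ) (hk : 1 ≤ k) : Measurable (Z k) := h.measurable_robbinsMonro γ hk
  have hγpos (k : ℕ) (hk : 1 ≤ k) : 0 < γ k := by
    have : (0 : ℝ) < k := by exact_mod_cast hk
    positivity
  have hγinv (k : ℕ) : (γ k)⁻¹ = c⁻¹ * (k : ℝ) ^ α := by
    simp only [hγ]
    rw [mul_inv, Real.rpow_neg (by positivity), inv_inv]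
  have hTmem (k : ℕ) (hk : 1 ≤ k) : MemLp (fun ω => Z k ω - m) ((2 * p : ℕ) : ℝ≥0∞) P := by
    obtain ⟨R, hR⟩ := h.bdd_robbinsMonro γ hk
    exact MemLp.of_bound ((hZm k hk).sub_const m).aestronglyMeasurable (R + ‖m‖)
      (hR.mono fun ω hω => (norm_sub_le _ _).trans (by linarith))
  have hT (k : ℕ) (hk : 1 ≤ k) : eLpNorm (fun ω => Z k ω - m) ((2 * p : ℕ) : ℝ≥0∞) P ≤
      ENNReal.ofReal (b * (k : ℝ) ^ (-(α / 2))) := by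
    rw [eLpNorm_le_ofReal_iff h2p (hTmem k hk) (by positivity), mul_pow]
    have e : ((k : ℝ) ^ (-(α / 2))) ^ (2 * p) = ((k : ℝ) ^ (-α)) ^ p := by
      rw [pow_mul, ← Real.rpow_natCast ((k : ℝ) ^ (-(α / 2))) 2, ← Real.rpow_mul (by positivity)]
      norm_num
    rw [e]
    refine (hB₁ k hk).trans ?_
    gcongr
    linarith
  -- the linearization error is quadratic, so its size is of the order of `γ_k`
  set δ : ℕ → Ω → H := fun k ω => meanDirection μ (Z k ω) + hessian hw (Z k ω - m) with hδ
  have hδle (k : ℕ) (ω : Ω) : ‖δ k ω‖ ≤ K * ‖Z k ω - m‖ ^ 2 := by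
    have := htaylor (Z k ω - m)
    rwa [add_sub_cancel] at this
  have hδm (k : ℕ) (hk : 1 ≤ k) : Measurable (δ k) :=
    ((stronglyMeasurable_meanDirection μ).measurable.comp (hZm k hk)).add
      ((continuous_hessian hw).measurable.comp ((hZm k hk).sub_const m))
  have hδmem (k : ℕ) (hk : 1 ≤ k) : MemLp (δ k) ((2 * p : ℕ) : ℝ≥0∞) P := by
    obtain ⟨R, hR⟩ := h.bdd_robbinsMonro γ hk
    refine MemLp.of_bound (hδm k hk).aestronglyMeasurable (K * (R + ‖m‖) ^ 2)
      (hR.mono fun ω hω => (hδle k ω).trans ?_)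
    have : ‖Z k ω - m‖ ≤ R + ‖m‖ := (norm_sub_le _ _).trans (by linarith)
    gcongr
  have hsqrt (x : ℝ) (hx : 1 ≤ x) : x ^ (-α) ≤ (√x)⁻¹ := by
    have : (√x)⁻¹ = x ^ (-(1 / 2) : ℝ) := by
      rw [Real.rpow_neg (by linarith), Real.sqrt_eq_rpow]
    rw [this]
    exact Real.rpow_le_rpow_of_exponent_le hx (by linarith)
  have hδN (k : ℕ) (hk : 1 ≤ k) : eLpNorm (δ k) ((2 * p : ℕ) : ℝ≥0∞) P ≤
      ENNReal.ofReal (K * b * (√(k : ℝ))⁻¹) := by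
    have hk1 : (1 : ℝ) ≤ k := by exact_mod_cast hk
    rw [eLpNorm_le_ofReal_iff h2p (hδmem k hk) (by positivity)]
    have hi : Integrable (fun ω => ‖Z k ω - m‖ ^ (2 * (2 * p))) P := by
      obtain ⟨R, hR⟩ := h.bdd_robbinsMonro γ hk
      refine Integrable.of_bound
        (((hZm k hk).sub_const m).norm.pow_const _).aestronglyMeasurable
        ((R + ‖m‖) ^ (2 * (2 * p))) (hR.mono fun ω hω => ?_)
      rw [norm_pow, norm_norm]
      have : ‖Z k ω - m‖ ≤ R + ‖m‖ := (norm_sub_le _ _).trans (by linarith)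
      gcongr
    calc ∫ ω, ‖δ k ω‖ ^ (2 * p) ∂P
        ≤ ∫ ω, K ^ (2 * p) * ‖Z k ω - m‖ ^ (2 * (2 * p)) ∂P := by
          refine integral_mono_of_nonneg (Filter.Eventually.of_forall fun ω => by positivity)
            (hi.const_mul _) (Filter.Eventually.of_forall fun ω => ?_)
          dsimp only
          rw [pow_mul _ 2 (2 * p), ← mul_pow]
          exact pow_le_pow_left₀ (norm_nonneg _) (hδle k ω) _
      _ = K ^ (2 * p) * ∫ ω, ‖Z k ω - m‖ ^ (2 * (2 * p)) ∂P := integral_const_mul _ _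
      _ ≤ K ^ (2 * p) * (b ^ (2 * p) * ((√(k : ℝ))⁻¹) ^ (2 * p)) := by
          gcongr
          refine (hB₂ k hk).trans ?_
          have := hsqrt k hk1
          gcongr
          linarith
      _ = _ := by rw [mul_pow, mul_pow]; ring
  set ρ : ℕ → Ω → H := fun k ω => ((γ (k + 1))⁻¹ - (γ k)⁻¹) • (Z (k + 1) ω - m) with hρ
  have hρN (k : ℕ) (hk : 1 ≤ k) : eLpNorm (ρ k) ((2 * p : ℕ) : ℝ≥0∞) P ≤
      ENNReal.ofReal (c⁻¹ * b * (√(k : ℝ))⁻¹) := by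
    have hk1 : (1 : ℝ) ≤ k := by exact_mod_cast hk
    have hs : eLpNorm (ρ k) ((2 * p : ℕ) : ℝ≥0∞) P = _ :=
      eLpNorm_const_smul ((γ (k + 1))⁻¹ - (γ k)⁻¹) (fun ω => Z (k + 1) ω - m) _ P
    have hmono : (k : ℝ) ^ α ≤ ((k : ℝ) + 1) ^ α := by gcongr; linarith
    have hab : ‖(γ (k + 1))⁻¹ - (γ k)⁻¹‖ₑ =
        ENNReal.ofReal (c⁻¹ * (((k : ℝ) + 1) ^ α - (k : ℝ) ^ α)) := by
      rw [hγinv, hγinv, ← mul_sub, ← ofReal_norm, Real.norm_eq_abs, abs_of_nonneg] <;> push_cast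
      · rfl
      · exact mul_nonneg (by positivity) (by linarith)
    rw [hs, hab]
    refine (mul_le_mul_right (hT (k + 1) (by omega)) _).trans ?_
    rw [← ENNReal.ofReal_mul (mul_nonneg (by positivity) (by linarith))]
    refine ENNReal.ofReal_le_ofReal ?_
    have := mul_le_mul_of_nonneg_left (rpow_add_one_sub_rpow_mul_le hα0 hα1 hk1)
      (by positivity : 0 ≤ c⁻¹ * b)
    push_cast
    linarith
  have hMmem (n : ℕ) : MemLp (noiseSum μ γ X Z₁ n) ((2 * p : ℕ) : ℝ≥0∞) P :=
    MemLp.of_bound (h.measurable_noiseSum γ n).aestronglyMeasurable (n * 2)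
      (Filter.Eventually.of_forall (norm_noiseSum_le μ γ X Z₁ n))
  have hMN (n : ℕ) (hn : 1 ≤ n) : eLpNorm (noiseSum μ γ X Z₁ n) ((2 * p : ℕ) : ℝ≥0∞) P ≤
      ENNReal.ofReal (b * √(n : ℝ)) := by
    rw [eLpNorm_le_ofReal_iff h2p (hMmem n) (by positivity), mul_pow, pow_mul (√(n : ℝ)),
      Real.sq_sqrt (by positivity)]
    calc ∫ ω, ‖noiseSum μ γ X Z₁ n ω‖ ^ (2 * p) ∂P
        ≤ ∫ ω, (‖noiseSum μ γ X Z₁ n ω‖ ^ 2 + 32) ^ p ∂P := by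
          refine integral_mono_of_nonneg (Filter.Eventually.of_forall fun ω => by positivity)
            (h.integrable_noiseSum_pow γ n p) (Filter.Eventually.of_forall fun ω => ?_)
          dsimp only
          rw [pow_mul]
          gcongr
          linarith
      _ ≤ B₃ * (n : ℝ) ^ p := hB₃ n hn
      _ ≤ b ^ (2 * p) * (n : ℝ) ^ p := by gcongr; linarith
  have hγT (k : ℕ) (hk : 1 ≤ k) : eLpNorm (fun ω => (γ k)⁻¹ • (Z k ω - m))
      ((2 * p : ℕ) : ℝ≥0∞) P ≤ ENNReal.ofReal (c⁻¹ * b * √(k : ℝ)) := by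
    have hk1 : (1 : ℝ) ≤ k := by exact_mod_cast hk
    have hk0 : (0 : ℝ) < k := by linarith
    have hs : eLpNorm (fun ω => (γ k)⁻¹ • (Z k ω - m)) ((2 * p : ℕ) : ℝ≥0∞) P = _ :=
      eLpNorm_const_smul ((γ k)⁻¹) (fun ω => Z k ω - m) _ P
    have hab : ‖(γ k)⁻¹‖ₑ = ENNReal.ofReal (c⁻¹ * (k : ℝ) ^ α) := by
      rw [hγinv, ← ofReal_norm, Real.norm_eq_abs, abs_of_nonneg (by positivity)]
    rw [hs, hab]
    refine (mul_le_mul_right (hT k hk) _).trans ?_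
    rw [← ENNReal.ofReal_mul (by positivity)]
    refine ENNReal.ofReal_le_ofReal ?_
    have e : (k : ℝ) ^ α * (k : ℝ) ^ (-(α / 2)) ≤ √(k : ℝ) := by
      rw [← Real.rpow_add hk0, Real.sqrt_eq_rpow]
      exact Real.rpow_le_rpow_of_exponent_le hk1 (by linarith)
    have := mul_le_mul_of_nonneg_left e (by positivity : 0 ≤ c⁻¹ * b)
    linarith
  -- the sum of all contributions
  set D := 2 * (K * b + c⁻¹ * b) + 2 * b + c⁻¹ * b + 2 * (c⁻¹ * b) with hD
  have hD0 : 0 < D := by positivity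
  set S : ℕ → Ω → H := fun n ω => ∑ k ∈ Finset.Icc 1 n, hessian hw (Z k ω - m) with hS
  have hSN (n : ℕ) (hn : 1 ≤ n) : eLpNorm (S n) ((2 * p : ℕ) : ℝ≥0∞) P ≤
      ENNReal.ofReal (D * √(n : ℝ)) := by
    have hn1 : (1 : ℝ) ≤ n := by exact_mod_cast hn
    have hρm (k : ℕ) : Measurable (ρ k) := ((hZm (k + 1) (by omega)).sub_const m).const_smul _
    have hgm (k : ℕ) (hk : 1 ≤ k) : Measurable (fun ω => (γ k)⁻¹ • (Z k ω - m)) :=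
      ((hZm k hk).sub_const m).const_smul _
    have e : S n = (∑ k ∈ Finset.Icc 1 n, (δ k + ρ k)) +
        (noiseSum μ γ X Z₁ (n + 1) + (fun ω => (γ 1)⁻¹ • (Z 1 ω - m)) -
          fun ω => (γ (n + 1))⁻¹ • (Z (n + 1) ω - m)) := by
      ext ω
      simp only [hS, Pi.add_apply, Pi.sub_apply, Finset.sum_apply]
      exact sum_hessian_eq hw (fun k hk => (hγpos k hk).ne') X Z₁ n ω
    have hsum1 : AEStronglyMeasurable (∑ k ∈ Finset.Icc 1 n, (δ k + ρ k)) P :=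
      Finset.aestronglyMeasurable_sum _ fun k hk =>
        ((hδm k (Finset.mem_Icc.1 hk).1).add (hρm k)).aestronglyMeasurable
    have hM1 := (h.measurable_noiseSum γ (n + 1)).aestronglyMeasurable (μ := P)
    have hg1 := (hgm 1 le_rfl).aestronglyMeasurable (μ := P)
    have hgn := (hgm (n + 1) (by omega)).aestronglyMeasurable (μ := P)
    have hsq : √((n + 1 : ℕ) : ℝ) ≤ 2 * √(n : ℝ) := by
      rw [Real.sqrt_le_left (by positivity), mul_pow, Real.sq_sqrt (by positivity)]
      push_cast; linarith
    have hs1 : (1 : ℝ) ≤ √(n : ℝ) := Real.one_le_sqrt.2 hn1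
    have t1 : eLpNorm (∑ k ∈ Finset.Icc 1 n, (δ k + ρ k)) ((2 * p : ℕ) : ℝ≥0∞) P ≤
        ENNReal.ofReal (2 * (K * b + c⁻¹ * b) * √(n : ℝ)) := by
      refine (eLpNorm_sum_le (fun k hk =>
        ((hδm k (Finset.mem_Icc.1 hk).1).add (hρm k)).aestronglyMeasurable) hone).trans ?_
      calc ∑ k ∈ Finset.Icc 1 n, eLpNorm (δ k + ρ k) ((2 * p : ℕ) : ℝ≥0∞) P
          ≤ ∑ k ∈ Finset.Icc 1 n, ENNReal.ofReal ((K * b + c⁻¹ * b) * (√(k : ℝ))⁻¹) := by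
            refine Finset.sum_le_sum fun k hk => ?_
            have hk := (Finset.mem_Icc.1 hk).1
            refine (eLpNorm_add_le (hδm k hk).aestronglyMeasurable
              (hρm k).aestronglyMeasurable hone).trans
              ((add_le_add (hδN k hk) (hρN k hk)).trans_eq ?_)
            rw [← ENNReal.ofReal_add (by positivity) (by positivity), add_mul]
        _ = ENNReal.ofReal ((K * b + c⁻¹ * b) * ∑ k ∈ Finset.Icc 1 n, (√(k : ℝ))⁻¹) := by
            rw [Finset.mul_sum, ENNReal.ofReal_sum_of_nonneg fun k _ => by positivity]
        _ ≤ _ := by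
            refine ENNReal.ofReal_le_ofReal ?_
            have := mul_le_mul_of_nonneg_left (sum_inv_sqrt_le n)
              (by positivity : 0 ≤ K * b + c⁻¹ * b)
            linarith
    have t2 : eLpNorm (noiseSum μ γ X Z₁ (n + 1)) ((2 * p : ℕ) : ℝ≥0∞) P ≤
        ENNReal.ofReal (2 * b * √(n : ℝ)) := by
      refine (hMN (n + 1) (by omega)).trans (ENNReal.ofReal_le_ofReal ?_)
      nlinarith
    have t3 : eLpNorm (fun ω => (γ 1)⁻¹ • (Z 1 ω - m)) ((2 * p : ℕ) : ℝ≥0∞) P ≤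
        ENNReal.ofReal (c⁻¹ * b * √(n : ℝ)) := by
      refine (hγT 1 le_rfl).trans (ENNReal.ofReal_le_ofReal ?_)
      have : (0 : ℝ) ≤ c⁻¹ * b := by positivity
      simp only [Nat.cast_one, Real.sqrt_one]
      nlinarith
    have t4 : eLpNorm (fun ω => (γ (n + 1))⁻¹ • (Z (n + 1) ω - m)) ((2 * p : ℕ) : ℝ≥0∞) P ≤
        ENNReal.ofReal (2 * (c⁻¹ * b) * √(n : ℝ)) := by
      refine (hγT (n + 1) (by omega)).trans (ENNReal.ofReal_le_ofReal ?_)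
      have : (0 : ℝ) ≤ c⁻¹ * b := by positivity
      nlinarith
    rw [e]
    refine (eLpNorm_add_le hsum1 ((hM1.add hg1).sub hgn) hone).trans ?_
    refine (add_le_add t1 ((eLpNorm_sub_le (hM1.add hg1) hgn hone).trans
      (add_le_add ((eLpNorm_add_le hM1 hg1 hone).trans (add_le_add t2 t3)) t4))).trans_eq ?_
    rw [← ENNReal.ofReal_add (by positivity) (by positivity),
      ← ENNReal.ofReal_add (by positivity) (by positivity),
      ← ENNReal.ofReal_add (by positivity) (by positivity)]
    congr 1
    rw [hD]; ring
  have hSmem (n : ℕ) : MemLp (S n) ((2 * p : ℕ) : ℝ≥0∞) P := by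
    have : MemLp (fun ω => ∑ k ∈ Finset.Icc 1 n, (hessian hw (Z k ω - m)))
        ((2 * p : ℕ) : ℝ≥0∞) P := by
      refine memLp_finsetSum _ fun k hk => ?_
      have hk := (Finset.mem_Icc.1 hk).1
      have hmd : MemLp (fun ω => meanDirection μ (Z k ω)) ((2 * p : ℕ) : ℝ≥0∞) P :=
        MemLp.of_bound
          ((stronglyMeasurable_meanDirection μ).measurable.comp (hZm k hk)).aestronglyMeasurable 1
          (Filter.Eventually.of_forall fun ω => norm_meanDirection_le_one μ _)
      have := (hδmem k hk).sub hmd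
      refine this.congr_norm ?_ (Filter.Eventually.of_forall fun ω => ?_)
      · exact ((continuous_hessian hw).measurable.comp
          ((hZm k hk).sub_const m)).aestronglyMeasurable
      · simp [hδ]
    exact this
  -- coercivity turns the bound on the Hessian into a bound on the average
  have hcoer' (v : H) : κ * ‖v‖ ≤ ‖hessian hw v‖ := by
    rcases eq_or_ne v 0 with rfl | hv
    · simp
    have hv0 : 0 < ‖v‖ := norm_pos_iff.2 hv
    have h1 := (hcoer v).trans (real_inner_le_norm _ _)
    have h2 : κ * ‖v‖ * ‖v‖ ≤ ‖hessian hw v‖ * ‖v‖ := by linarith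
    exact le_of_mul_le_mul_right h2 hv0
  have havg (n : ℕ) (hn : 1 ≤ n) (ω : Ω) :
      ‖averaged Z n ω - m‖ ≤ (κ * n)⁻¹ * ‖S n ω‖ := by
    have hn0 : (0 : ℝ) < n := by exact_mod_cast hn
    have e1 : averaged Z n ω - m = (n : ℝ)⁻¹ • ∑ k ∈ Finset.Icc 1 n, (Z k ω - m) := by
      rw [Finset.sum_sub_distrib, Finset.sum_const, Nat.card_Icc, Nat.add_sub_cancel, smul_sub,
        ← Nat.cast_smul_eq_nsmul ℝ, smul_smul, inv_mul_cancel₀ hn0.ne', one_smul]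
      rfl
    have e2 : hessian hw (averaged Z n ω - m) = (n : ℝ)⁻¹ • S n ω := by
      rw [e1, map_smul, map_sum]
    have h1 := hcoer' (averaged Z n ω - m)
    rw [e2, norm_smul, Real.norm_eq_abs, abs_of_pos (inv_pos.2 hn0)] at h1
    rw [mul_inv, mul_assoc, inv_mul_eq_div, le_div_iff₀ hκ]
    linarith
  refine ⟨(κ⁻¹ * D) ^ (2 * p), by positivity, fun n hn => ?_⟩
  have hn0 : (0 : ℝ) < n := by exact_mod_cast hn
  have hSi : Integrable (fun ω => ‖S n ω‖ ^ (2 * p)) P := (hSmem n).integrable_norm_pow h2p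
  have hSb := (eLpNorm_le_ofReal_iff h2p (hSmem n) (by positivity)).1 (hSN n hn)
  have hle (ω : Ω) : ‖averaged Z n ω - m‖ ^ (2 * p) ≤
      ((κ * n)⁻¹) ^ (2 * p) * ‖S n ω‖ ^ (2 * p) := by
    rw [← mul_pow]
    exact pow_le_pow_left₀ (norm_nonneg _) (havg n hn ω) _
  have hAm : Measurable (averaged Z n) := by
    have : Measurable (fun ω => ∑ k ∈ Finset.Icc 1 n, Z k ω) :=
      Finset.measurable_fun_sum _ fun k hk => hZm k (Finset.mem_Icc.1 hk).1
    exact this.const_smul _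
  have hi : Integrable (fun ω => ‖averaged Z n ω - m‖ ^ (2 * p)) P := by
    refine (hSi.const_mul (((κ * n)⁻¹) ^ (2 * p))).mono'
      ((hAm.sub_const m).norm.pow_const _).aestronglyMeasurable
      (Filter.Eventually.of_forall fun ω => ?_)
    rw [norm_pow, norm_norm]
    exact hle ω
  refine ⟨hi, ?_⟩
  calc ∫ ω, ‖averaged Z n ω - m‖ ^ (2 * p) ∂P
      ≤ ∫ ω, ((κ * n)⁻¹) ^ (2 * p) * ‖S n ω‖ ^ (2 * p) ∂P :=
        integral_mono hi (hSi.const_mul _) hle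
    _ = ((κ * n)⁻¹) ^ (2 * p) * ∫ ω, ‖S n ω‖ ^ (2 * p) ∂P := integral_const_mul _ _
    _ ≤ ((κ * n)⁻¹) ^ (2 * p) * (D * √(n : ℝ)) ^ (2 * p) := by gcongr
    _ = (κ⁻¹ * D) ^ (2 * p) / (n : ℝ) ^ p := by
        rw [mul_pow D, pow_mul (√(n : ℝ)), Real.sq_sqrt hn0.le, mul_inv, mul_pow, mul_pow,
          inv_pow (n : ℝ), mul_comm 2 p, pow_mul (n : ℝ)]
        field_simp

end Averaging

/-! ### From the assumptions on the random variable to its law -/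

section Assumptions

variable {Ω H : Type*} [NormedAddCommGroup H] [MeasurableSpace H] [MeasurableSpace Ω]
  {P : Measure Ω} {X : Ω → H}

theorem IsGeometricMedian.integral_norm_sub_nonneg [BorelSpace H] {m : H} [IsProbabilityMeasure P]
    (h : IsGeometricMedian X P m) (hX : Measurable X) (t : H) :
    0 ≤ ∫ x, (‖x - (m + t)‖ - ‖x - m‖) ∂(P.map X) := by
  have hint (z : H) : Integrable (fun ω => ‖X ω - z‖ - ‖X ω‖) P := by
    refine Integrable.of_bound (by fun_prop : Measurable _).aestronglyMeasurable ‖z‖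
      (Filter.Eventually.of_forall fun ω => ?_)
    rw [Real.norm_eq_abs]
    refine (abs_norm_sub_norm_le _ _).trans_eq ?_
    rw [sub_sub_cancel_left, norm_neg]
  have h1 := isMinOn_iff.1 h (m + t) (Set.mem_univ _)
  rw [integral_map hX.aemeasurable (by fun_prop : Measurable _).aestronglyMeasurable]
  have e : ∫ ω, (‖X ω - (m + t)‖ - ‖X ω - m‖) ∂P =
      ∫ ω, (‖X ω - (m + t)‖ - ‖X ω‖) ∂P - ∫ ω, (‖X ω - m‖ - ‖X ω‖) ∂P := by
    rw [← integral_sub (hint _) (hint _)]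
    simp
  rw [e]
  linarith

theorem NotConcentratedOnLine.exists_not_ae_inner_eq_zero [InnerProductSpace ℝ H]
    [IsProbabilityMeasure P]
    (h : NotConcentratedOnLine X P) (hX : Measurable X) (m v : H) :
    ∃ h' : H, inner ℝ v h' = 0 ∧ ¬ ∀ᵐ x ∂(P.map X), inner ℝ (x - m) h' = 0 := by
  obtain ⟨h', hv, hvar⟩ := h v
  refine ⟨h', hv, fun hae => hvar.ne' ?_⟩
  have h1 := ae_of_ae_map hX.aemeasurable hae
  have h2 : (fun ω => (inner ℝ (X ω) h' : ℝ)) =ᵐ[P] fun _ => inner ℝ m h' := by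
    filter_upwards [h1] with ω hω
    rw [inner_sub_left] at hω
    linarith
  rw [evariance_congr h2]
  simp [evariance]

variable [BorelSpace H] [SecondCountableTopology H]

theorem NotConcentratedAroundPoints.ae_ne (h : NotConcentratedAroundPoints X P) (hX : Measurable X)
    (m : H) : ∀ᵐ x ∂(P.map X), x ≠ m := by
  obtain ⟨C, -, hC⟩ := h
  have h1 := ((hC m).1.trans_lt ENNReal.ofReal_lt_top).ne
  rw [ae_map_iff hX.aemeasurable (p := fun x => x ≠ m) (measurableSet_singleton m).compl]
  have hm : Measurable fun ω => (‖X ω - m‖ₑ)⁻¹ := ((hX.sub_const m).enorm).inv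
  filter_upwards [ae_lt_top hm h1] with ω hω hXm
  simp [hXm] at hω

theorem NotConcentratedAroundPoints.integrable_inv (h : NotConcentratedAroundPoints X P)
    (hX : Measurable X) (m : H) : Integrable (fun x => ‖x - m‖⁻¹) (P.map X) := by
  have hne := h.ae_ne hX m
  obtain ⟨C, -, hC⟩ := h
  refine ⟨(by fun_prop : Measurable _).aestronglyMeasurable, ?_⟩
  have hm : Measurable fun x : H => (‖x - m‖ₑ)⁻¹ := ((measurable_id.sub_const m).enorm).inv
  refine lt_of_le_of_lt ?_ ((hC m).1.trans_lt ENNReal.ofReal_lt_top)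
  rw [← lintegral_map hm hX]
  refine lintegral_mono_ae ?_
  filter_upwards [hne] with x hx
  rw [enorm_inv (norm_ne_zero_iff.2 (sub_ne_zero.2 hx)), enorm_norm]

theorem NotConcentratedAroundPoints.integrable_inv_sq (h : NotConcentratedAroundPoints X P)
    (hX : Measurable X) (m : H) : Integrable (fun x => ‖x - m‖⁻¹ ^ 2) (P.map X) := by
  have hne := h.ae_ne hX m
  obtain ⟨C, -, hC⟩ := h
  refine ⟨(by fun_prop : Measurable _).aestronglyMeasurable, ?_⟩
  have hm : Measurable fun x : H => (‖x - m‖ₑ ^ 2)⁻¹ :=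
    (((measurable_id.sub_const m).enorm).pow_const 2).inv
  refine lt_of_le_of_lt ?_ ((hC m).2.trans_lt ENNReal.ofReal_lt_top)
  rw [← lintegral_map hm hX]
  refine lintegral_mono_ae ?_
  filter_upwards [hne] with x hx
  rw [enorm_pow, enorm_inv (norm_ne_zero_iff.2 (sub_ne_zero.2 hx)), enorm_norm, ENNReal.inv_pow]

end Assumptions

theorem theorem4p2
    {H : Type*} [NormedAddCommGroup H] [InnerProductSpace ℝ H] [CompleteSpace H]
    [TopologicalSpace.SeparableSpace H] [MeasurableSpace H] [BorelSpace H]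
    {Ω : Type*} [MeasurableSpace Ω] (P : Measure Ω) [IsProbabilityMeasure P]
    -- the variable `X`, its assumptions, and its geometric median `m`
    (X : Ω → H) (hX : Measurable X)
    (hA1 : NotConcentratedOnLine X P) (hA2 : NotConcentratedAroundPoints X P)
    (m : H) (hm : IsGeometricMedian X P m)
    -- the sample `X_1, X_2, …` (`Xs 0` is not used)
    (Xs : ℕ → Ω → H) (hXs : ∀ n, 1 ≤ n → Measurable (Xs n))
    (hindep : iIndepFun (fun n : ℕ => Xs (n + 1)) P)
    (hident : ∀ n, 1 ≤ n → IdentDistrib (Xs n) X P P)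
    -- the initialization: bounded, and independent of `X_2, X_3, …`
    (Z₁ : Ω → H) (hZ₁ : Measurable Z₁) (hbdd : ∃ M : ℝ, ∀ᵐ ω ∂P, ‖Z₁ ω‖ ≤ M)
    (hZ₁indep : IndepFun Z₁ (fun ω (n : ℕ) => Xs (n + 2) ω) P)
    -- the steps `γ_n = c n ^ (-α)`
    (c α : ℝ) (hc : 0 < c) (hα : α ∈ Set.Ioo (1 / 2 : ℝ) 1)
    (p : ℕ) (hp : 1 ≤ p) :
    ∃ A : ℝ, 0 < A ∧ ∀ n : ℕ, 1 ≤ n →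
      Integrable (fun ω =>
        ‖averaged (robbinsMonro (fun k : ℕ => c * (k : ℝ) ^ (-α)) Xs Z₁) n ω - m‖ ^ (2 * p)) P ∧
      ∫ ω, ‖averaged (robbinsMonro (fun k : ℕ => c * (k : ℝ) ^ (-α)) Xs Z₁) n ω - m‖ ^ (2 * p) ∂P
        ≤ A / (n : ℝ) ^ p := by
  have := UniformSpace.secondCountable_of_separable H
  have : IsProbabilityMeasure (P.map X) := Measure.isProbabilityMeasure_map hX.aemeasurable
  have hw := hA2.integrable_inv hX m
  have hw2 := hA2.integrable_inv_sq hX m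
  have hne := hA2.ae_ne hX m
  have hline := hA1.exists_not_ae_inner_eq_zero hX m
  have hmin := hm.integral_norm_sub_nonneg hX
  have hsample : IsSample P (P.map X) Xs Z₁ :=
    ⟨hXs, fun n hn => (hident n hn).map_eq, hindep, hZ₁, hbdd, hZ₁indep⟩
  obtain ⟨κ, hκ, hcoer⟩ := exists_le_inner_hessian_self hw hne hline
  obtain ⟨l, hl, hdrift⟩ := exists_le_neg_inner_meanDirection hw hw2 hne hline hmin
  refine hsample.exists_integral_averaged_pow_le hw hκ
    (mul_nonneg zero_le_four (integral_nonneg (μ := P.map X) fun x => sq_nonneg ‖x - m‖⁻¹)) hl hcoer (fun t => ?_) hdrift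
    hc hα.1 hα.2 hp
  have := norm_meanDirection_taylor_le hw hw2 hne t
  rwa [meanDirection_eq_zero hw hw2 hne hmin, sub_zero] at this
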